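/- **Setting.** Let $\Gamma$ be the (countable) vertex set of a connected graph with graph distance $d(x,y)$. Let $F:[0,\infty)\to(0,\infty)$ satisfy $$\|F\|:=\sup_{x}\sum_{y}F(d(x,y))<\infty,\qquad C_F:=\sup_{x,z}\sum_{y}\frac{F(d(x,y))F(d(y,z))}{F(d(x,z))}<\infty ,$$ and let $\xi:[0,\infty)\to(0,\infty)$ be non-increasing with $\xi(a+b)\ge\xi(a)\xi(b)$ and $\lim_{r\to\infty}\xi(r)r^n=0$ for all $n\in\mathbb N$. Put $F_\xi:=F\xi$, let $\|F_\xi\|$ and $C_\xi$ be the constants above for $F_\xi$ in place of $F$, and put $\zeta(n):=\sum_{r\ge n+1}\xi(r)$ (sum over integers $r$). For finite $\Lambda\subset\Gamma$ let $\mathcal H_\Lambda=\bigotimes_{x\in\Lambda}\mathcal H_x$ with $\dim\mathcal H_x<\infty$ and $\mathcal A_\Lambda=\mathcal B(\mathcal H_\Lambda)$, embedded in $\mathcal A_{\Lambda'}$ for $\Lambda'\supset\Lambda$ by tensoring with the identity. Let $T\in(0,\infty)$. For each finite $Z$ let $\Psi(Z,t)=\Psi(Z,t)^*\in\mathcal A_Z$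 be continuous in $t\in[-T,T]$, with $$\|\Psi\|_\xi:=\sup_{x,y}\frac1{F_\xi(d(x,y))}\sum_{Z\ni x,y}\ \sup_{t\in[-T,T]}\|\Psi(Z,t)\|<\infty .$$ Let $H_\Lambda(t)=\sum_{\emptyset\ne Z\subset\Lambda}\Psi(Z,t)$, let $U_\Lambda(t,s)$ be the solution of $\mathrm i\frac{d}{dt}U_\Lambda(t,s)=H_\Lambda(t)U_\Lambda(t,s)$, $U_\Lambda(s,s)=1$, for $s,t\in[-T,T]$, and let $\sigma_\Lambda^{t,s}(A)=U_\Lambda(t,s)AU_\Lambda(t,s)^*$. Put $v_\xi=2\|\Psi\|_\xi C_\xi$. For finite $X\subset\Gamma$ and integers $n\ge0$ let $\overline X^{n}=\{x: d(x,X)\le n\}$, $\underline X_{n}=\{x:d(x,\Gamma\setminus X)\le n\}$, $\partial_nX=\overline X^{n}\cap\underline X_{n}$ and $\partial X=\{x\in X:d(x,\Gamma\setminus X)=1\}$. Assume that there are $G>0$ and an exponent $D\ge0$ with $|\partial_nX|\le G\,n^{D}|\partial X|$ for all finite $X\subset\Gamma$ and all integers $n\ge0$ (with $0^0=1$). Fix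 a finite $X\subset\Gamma$ such that $n\mapsto|\underline X_{n}\setminus\underline X_{n-1}|$ is non-increasing on $n\ge1$, an integer $R\ge0$, and a finite $\Lambda\supset\overline X^{R}$. Let $$S(R,t)=\sum\Psi(Z,t)\quad\text{over } Z\subset\partial_{\lfloor R/2\rfloor}X \text{ with } Z\cap X\neq\emptyset,\ Z\cap(\Lambda\setminus X)\ne\emptyset,$$ $$K(t)=-\sum\Psi(Z,t)\quad\text{over } Z\subset\Lambda \text{ with } Z\cap X\neq\emptyset,\ Z\cap(\Lambda\setminus X)\ne\emptyset .$$ **Theorem.** There is a family $\hat U(t,s)=\hat U_{\partial_RX}(t,s)\in\mathcal A_{\partial_RX}$, $t,s\in[-T,T]$, solving $$-\mathrm i\frac{d}{ds}\hat U(t,s)^*=\sigma_{\partial_RX}^{t,s}(S(R,s))\,\hat U(t,s)^*,\qquad \hat U(t,t)^*=1 ,$$ and for any such family and all $t,s\in[-T,T]$ the operator $\hat U(t,s)$ is unitary and, with $W(t,s)=\big(U_X(t,s)\otimes U_{\Lambda\setminus X}(t,s)\big)U_\Lambda(t,s)^*$, $$\big\|U_\Lambda(t,s)-\hat U(t,s)^*\big(U_X(t,s)\otimes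 U_{\Lambda\setminus X}(t,s)\big)\big\|=\big\|W(t,s)^*-\hat U(t,s)^*\big\|\le\Big|\int_s^t\big\|\sigma_\Lambda^{t,r}(K(r))+\sigma_{\partial_RX}^{t,r}(S(R,r))\big\|\,dr\Big| ,$$ and moreover $$\big\|U_\Lambda(t,s)-\hat U(t,s)^*\big(U_X(t,s)\otimes U_{\Lambda\setminus X}(t,s)\big)\big\|\le|\partial X|\,\|\Psi\|_\xi\|F\|\,|t-s|\Big[2\zeta(\lfloor R/2\rfloor)+|\partial X|\,\kappa\,\lfloor R/2\rfloor^{2D}\,\xi(\lfloor R/2\rfloor)\big(e^{v_\xi|t-s|}-1\big)\Big],$$ where $\kappa=G^2\|F_\xi\|/C_\xi$. -/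

import Mathlib

open scoped Matrix.Norms.L2Operator ENNReal

noncomputable section

namespace QSpin

/-! ## Geometry of the graph -/

section Geometry

variable {Γ : Type*}

/-- The set of points at graph distance at most `n` from `X`
(the distance to the empty set being infinite). -/
def thickening (G : SimpleGraph Γ) (X : Set Γ) (n : ℕ) : Set Γ :=
  {x | ∃ y ∈ X, G.dist x y ≤ n}

/-- The fattened surface: the points at distance at most `n` both from `X` and from the
complement of `X`. -/
def fatBoundary (G : SimpleGraph Γ) (X : Finset Γ) (n : ℕ) : Set Γ :=
  thickening G (X : Set Γ) n ∩ thickening G (X : Set Γ)ᶜ n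

/-- The layer of points whose distance to the complement of `X` is at most `n`
but not at most `n - 1`  (used for `1 ≤ n` only). -/
def layer (G : SimpleGraph Γ) (X : Finset Γ) (n : ℕ) : Set Γ :=
  thickening G (X : Set Γ)ᶜ n \ thickening G (X : Set Γ)ᶜ (n - 1)

/-- The inner boundary: the points of `X` at distance exactly one from the complement of `X`. -/
def innerBoundary (G : SimpleGraph Γ) (X : Finset Γ) : Set Γ :=
  {x | x ∈ X ∧ (∃ y ∉ X, G.dist x y = 1) ∧ ∀ y ∉ X, 1 ≤ G.dist x y}

lemma subset_of_thickening_subset {G : SimpleGraph Γ} {X Λ : Finset Γ} {n : ℕ}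
    (h : thickening G (X : Set Γ) n ⊆ (Λ : Set Γ)) : X ⊆ Λ := fun x hx =>
  Finset.mem_coe.1 (h ⟨x, Finset.mem_coe.2 hx, by simp⟩)

lemma fatBoundary_mono (G : SimpleGraph Γ) (X : Finset Γ) {m n : ℕ} (h : m ≤ n) :
    fatBoundary G X m ⊆ fatBoundary G X n := by
  rintro x ⟨⟨y, hy, hxy⟩, ⟨z, hz, hxz⟩⟩
  exact ⟨⟨y, hy, hxy.trans h⟩, ⟨z, hz, hxz.trans h⟩⟩

open Classical in
/-- The fattened surface as a finite subset of a finite volume `Λ`; it is all of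
`fatBoundary G X n` as soon as `Λ` contains `thickening G X n`. -/
def surface (G : SimpleGraph Γ) (X Λ : Finset Γ) (n : ℕ) : Finset Γ :=
  {x ∈ Λ | x ∈ fatBoundary G X n}

lemma surface_subset (G : SimpleGraph Γ) (X Λ : Finset Γ) (n : ℕ) : surface G X Λ n ⊆ Λ := by
  classical exact Finset.filter_subset _ _

lemma surface_mono (G : SimpleGraph Γ) (X Λ : Finset Γ) {m n : ℕ} (h : m ≤ n) :
    surface G X Λ m ⊆ surface G X Λ n := by
  intro x hx
  simp only [surface, Finset.mem_filter] at hx ⊢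
  exact ⟨hx.1, fatBoundary_mono G X h hx.2⟩

lemma coe_surface {G : SimpleGraph Γ} {X Λ : Finset Γ} {n : ℕ}
    (h : thickening G (X : Set Γ) n ⊆ (Λ : Set Γ)) :
    (surface G X Λ n : Set Γ) = fatBoundary G X n := by
  ext x
  simp only [surface, Finset.coe_filter, Set.mem_ofPred_eq, and_iff_right_iff_imp]
  exact fun hx => h hx.1

/-! ## Decay functions -/

/-- `‖F‖ = sup_x ∑_y F(d(x,y))`. -/
def decayNorm (G : SimpleGraph Γ) (F : ℝ → ℝ) : ℝ≥0∞ :=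
  ⨆ x : Γ, ∑' y : Γ, ENNReal.ofReal (F (G.dist x y))

/-- `C_F = sup_{x,z} ∑_y F(d(x,y)) F(d(y,z)) / F(d(x,z))`. -/
def convConst (G : SimpleGraph Γ) (F : ℝ → ℝ) : ℝ≥0∞ :=
  ⨆ (x : Γ) (z : Γ), ∑' y : Γ,
    ENNReal.ofReal (F (G.dist x y) * F (G.dist y z) / F (G.dist x z))

/-- `ζ(n) = ∑_{r ≥ n+1} ξ(r)`. -/
def zetaTail (ξ : ℝ → ℝ) (n : ℕ) : ℝ := ∑' k : ℕ, ξ ((n + 1 + k : ℕ) : ℝ)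

end Geometry

/-! ## Propagators -/

section Propagator

variable {A : Type*} [NormedRing A] [NormedAlgebra ℂ A]

/-- `U` solves `i dU(t,s)/dt = H(t) U(t,s)`, `U(s,s) = 1` for `s, t ∈ [-T,T]`
(with one-sided derivatives at the end points). -/
def IsPropagator (T : ℝ) (H : ℝ → A) (U : ℝ → ℝ → A) : Prop :=
  ∀ s ∈ Set.Icc (-T) T, U s s = 1 ∧ ∀ t ∈ Set.Icc (-T) T,
    HasDerivWithinAt (fun r => U r s) (-Complex.I • (H t * U t s)) (Set.Icc (-T) T) t

/-- The propagator generated by `H`: the solution of `i dU(t,s)/dt = H(t) U(t,s)`,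
`U(s,s) = 1` on `[-T,T]`. It exists for every continuous `H`, see `isPropagator_propagator`. -/
def propagator (T : ℝ) (H : ℝ → A) : ℝ → ℝ → A :=
  Classical.epsilon (IsPropagator T H)

/-- The terms of the Dyson series. -/
def dyson (B : ℝ → A) (s : ℝ) : ℕ → ℝ → A
  | 0 => fun _ => 1
  | n + 1 => fun t => ∫ r in s..t, B r * dyson B s n r

lemma continuous_dyson [CompleteSpace A] {B : ℝ → A} (hB : Continuous B) (s : ℝ) (n : ℕ) :
    Continuous (dyson B s n) := by
  induction n with
  | zero => exact continuous_const
  | succ n ih =>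
    exact intervalIntegral.continuous_primitive
      (fun a b => (hB.mul ih).intervalIntegrable a b) s

lemma hasDerivAt_dyson [CompleteSpace A] {B : ℝ → A} (hB : Continuous B) (s : ℝ) (n : ℕ)
    (t : ℝ) : HasDerivAt (dyson B s (n + 1)) (B t * dyson B s n t) t :=
  have h : Continuous fun r => B r * dyson B s n r := hB.mul (continuous_dyson hB s n)
  intervalIntegral.integral_hasDerivAt_right (h.intervalIntegrable _ _)
    h.aestronglyMeasurable.stronglyMeasurableAtFilter h.continuousAt

lemma norm_dyson_le {B : ℝ → A} {M : ℝ}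
    (hM : ∀ t, ‖B t‖ ≤ M) (s : ℝ) (n : ℕ) (t : ℝ) :
    ‖dyson B s n t‖ ≤ ‖(1 : A)‖ * ((M * |t - s|) ^ n / n.factorial) := by
  have hM0 : 0 ≤ M := (norm_nonneg _).trans (hM 0)
  induction n generalizing t with
  | zero => simp [dyson]
  | succ n ih =>
    have h1 : ∀ r, ‖B r * dyson B s n r‖
        ≤ (‖(1 : A)‖ * M ^ (n + 1) / n.factorial) * |r - s| ^ n := fun r => by
      calc ‖B r * dyson B s n r‖ ≤ ‖B r‖ * ‖dyson B s n r‖ := norm_mul_le _ _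
        _ ≤ M * (‖(1 : A)‖ * ((M * |r - s|) ^ n / n.factorial)) :=
          mul_le_mul (hM r) (ih r) (norm_nonneg _) hM0
        _ = _ := by rw [mul_pow]; ring
    have hc : Continuous fun r : ℝ =>
        (‖(1 : A)‖ * M ^ (n + 1) / n.factorial) * |r - s| ^ n := by fun_prop
    calc ‖∫ r in s..t, B r * dyson B s n r‖
        ≤ ∫ r in Set.uIoc s t, (‖(1 : A)‖ * M ^ (n + 1) / n.factorial) * |r - s| ^ n := by
          refine (intervalIntegral.norm_integral_le_integral_norm_uIoc).trans ?_
          refine MeasureTheory.integral_mono_of_nonneg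
            (Filter.Eventually.of_forall fun _ => norm_nonneg _) ?_
            (Filter.Eventually.of_forall h1)
          exact (hc.intervalIntegrable s t).def'
      _ = (‖(1 : A)‖ * M ^ (n + 1) / n.factorial) * (|t - s| ^ (n + 1) / (n + 1)) := by
          rw [MeasureTheory.integral_const_mul, integral_pow_abs_sub_uIoc]
      _ = ‖(1 : A)‖ * ((M * |t - s|) ^ (n + 1) / (n + 1).factorial) := by
          rw [Nat.factorial_succ, mul_pow]; push_cast; field_simp

lemma exists_linear_solution [CompleteSpace A] {B : ℝ → A} (hB : Continuous B) {M : ℝ}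
    (hM : ∀ t, ‖B t‖ ≤ M) (s : ℝ) :
    ∃ u : ℝ → A, u s = 1 ∧ ∀ t, HasDerivAt u (B t * u t) t := by
  have hM0 : 0 ≤ M := (norm_nonneg _).trans (hM 0)
  have hs : ∀ L : ℝ, Summable fun n : ℕ => ‖(1 : A)‖ * ((M * L) ^ n / n.factorial) :=
    fun L => (Real.summable_pow_div_factorial (M * L)).mul_left _
  have hsum : ∀ t, Summable fun n => dyson B s n t := fun t =>
    Summable.of_norm_bounded (hs |t - s|) fun n => norm_dyson_le hM s n t
  refine ⟨fun t => ∑' n, dyson B s n t, ?_, fun t => ?_⟩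
  · show ∑' n, dyson B s n s = 1
    rw [(hsum s).tsum_eq_zero_add]
    simp [dyson]
  · set L : ℝ := |t - s| + 1
    have hL : 0 < L := by positivity
    let g' : ℕ → ℝ → A := fun n => Nat.casesOn n (fun _ => 0) fun m r => B r * dyson B s m r
    let b : ℕ → ℝ := fun n => Nat.casesOn n 0 fun m =>
      M * (‖(1 : A)‖ * ((M * L) ^ m / m.factorial))
    have hb : Summable b := (summable_nat_add_iff 1).1 ((hs L).mul_left M)
    have key := hasDerivAt_tsum_of_isPreconnected (g := fun n => dyson B s n) (g' := g')
      (u := b) (t := Metric.ball s L) (y₀ := s) (y := t) hb Metric.isOpen_ball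
      (convex_ball s L).isPreconnected
      (fun n y _ => by
        cases n with
        | zero => exact hasDerivAt_const y (1 : A)
        | succ n => exact hasDerivAt_dyson hB s n y)
      (fun n y hy => by
        cases n with
        | zero => simp [g', b]
        | succ n =>
          have hy' : |y - s| ≤ L := by
            rw [Metric.mem_ball, Real.dist_eq] at hy; exact hy.le
          calc ‖B y * dyson B s n y‖ ≤ ‖B y‖ * ‖dyson B s n y‖ := norm_mul_le _ _
            _ ≤ M * (‖(1 : A)‖ * ((M * |y - s|) ^ n / n.factorial)) :=
              mul_le_mul (hM y) (norm_dyson_le hM s n y) (norm_nonneg _) hM0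
            _ ≤ M * (‖(1 : A)‖ * ((M * L) ^ n / n.factorial)) := by gcongr)
      (Metric.mem_ball_self hL) (hsum s)
      (by rw [Metric.mem_ball, Real.dist_eq]; exact lt_add_one _)
    have hg : ∑' n, g' n t = B t * ∑' n, dyson B s n t := by
      have h2 : Summable fun n => g' n t :=
        (summable_nat_add_iff 1).1 ((hsum t).mul_left (B t))
      rw [h2.tsum_eq_zero_add, ← (hsum t).tsum_mul_left]
      simp [g']
    rw [hg] at key
    exact key

/-- The propagator of a continuous generator is a solution of its defining equation. -/
theorem isPropagator_propagator [CompleteSpace A] {T : ℝ} (hT : 0 < T) {H : ℝ → A}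
    (hH : ContinuousOn H (Set.Icc (-T) T)) : IsPropagator T H (propagator T H) := by
  have hle : -T ≤ T := by linarith
  let B : ℝ → A := fun t => -Complex.I • H (Set.projIcc (-T) T hle t)
  have hB : Continuous B :=
    (hH.domRestrict.comp continuous_projIcc : Continuous
      fun t => H (Set.projIcc (-T) T hle t)).const_smul (-Complex.I)
  obtain ⟨M, hM⟩ := isCompact_Icc.exists_bound_of_continuousOn hH
  have hBM : ∀ t, ‖B t‖ ≤ M := fun t => by
    simpa [B, norm_smul] using hM _ (Set.projIcc (-T) T hle t).2
  choose u hu using fun s => exists_linear_solution hB hBM s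
  refine Classical.epsilon_spec (p := IsPropagator T H) ⟨fun t s => u s t, fun s _ => ?_⟩
  refine ⟨(hu s).1, fun t ht => ?_⟩
  have h := ((hu s).2 t).hasDerivWithinAt (s := Set.Icc (-T) T)
  have h3 : B t = -Complex.I • H t := by simp only [B, Set.projIcc_of_mem hle ht]
  rwa [h3, smul_mul_assoc] at h

end Propagator

/-! ## Quantum spin systems -/

section Spin

variable {Γ : Type*} [DecidableEq Γ] {q : Γ → ℕ}

/-- The configurations indexing the product orthonormal basis of `⨂_{x ∈ Λ} ℂ^{q x}`. -/
abbrev Config (q : Γ → ℕ) (Λ : Finset Γ) : Type _ := (x : Λ) → Fin (q x)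

/-- The algebra of all operators on `⨂_{x ∈ Λ} ℂ^{q x}`, with the operator norm, as matrices
in the product orthonormal basis. -/
abbrev LocalAlgebra (q : Γ → ℕ) (Λ : Finset Γ) : Type _ :=
  Matrix (Config q Λ) (Config q Λ) ℂ

/-- The tensor product `A ⊗ B` of operators supported in `Z` and in `Λ \ Z`. -/
def tensorOp {Z Λ : Finset Γ} (h : Z ⊆ Λ) (A : LocalAlgebra q Z)
    (B : LocalAlgebra q (Λ \ Z)) : LocalAlgebra q Λ :=
  Matrix.of fun σ σ' =>
    A (fun x => σ ⟨x, h x.2⟩) (fun x => σ' ⟨x, h x.2⟩) *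
      B (fun x => σ ⟨x, Finset.sdiff_subset x.2⟩) (fun x => σ' ⟨x, Finset.sdiff_subset x.2⟩)

/-- The canonical embedding of the operators supported in `Z` into those supported in `Λ`,
by tensoring with the identity. -/
def embed {Z Λ : Finset Γ} (h : Z ⊆ Λ) (A : LocalAlgebra q Z) : LocalAlgebra q Λ :=
  tensorOp h A 1

/-- The sum in `LocalAlgebra q Λ` of the interaction terms over a family `M` of subsets of `Λ`. -/
def interactionSum (Ψ : (Z : Finset Γ) → ℝ → LocalAlgebra q Z) {Λ : Finset Γ}
    (M : Finset (Finset Γ)) (hM : ∀ Z ∈ M, Z ⊆ Λ) (t : ℝ) : LocalAlgebra q Λ :=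
  ∑ Z ∈ M.attach, embed (hM Z.1 Z.2) (Ψ Z.1 t)

/-- The Hamiltonian `H_Λ(t)`, the sum of the `Ψ(Z,t)` over the nonempty `Z ⊆ Λ`. -/
def hamiltonian (Ψ : (Z : Finset Γ) → ℝ → LocalAlgebra q Z) (Λ : Finset Γ) (t : ℝ) :
    LocalAlgebra q Λ :=
  interactionSum Ψ {Z ∈ Λ.powerset | Z.Nonempty}
    (fun _ h => Finset.mem_powerset.1 (Finset.mem_filter.1 h).1) t

/-- `‖Ψ‖_ξ = sup_{x,y} F_ξ(d(x,y))⁻¹ ∑_{Z ∋ x,y} sup_{t ∈ [-T,T]} ‖Ψ(Z,t)‖`, where `Fξ` is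
the function `F_ξ`. -/
def interactionNorm (G : SimpleGraph Γ) (Fξ : ℝ → ℝ) (T : ℝ)
    (Ψ : (Z : Finset Γ) → ℝ → LocalAlgebra q Z) : ℝ≥0∞ :=
  ⨆ (x : Γ) (y : Γ), ENNReal.ofReal (1 / Fξ (G.dist x y)) *
    ∑' Z : {Z : Finset Γ // x ∈ Z ∧ y ∈ Z},
      ⨆ t ∈ Set.Icc (-T) T, ENNReal.ofReal ‖Ψ Z.1 t‖

/-- The unitary cocycle `U_Λ(t,s)`. -/
def evolution (T : ℝ) (Ψ : (Z : Finset Γ) → ℝ → LocalAlgebra q Z) (Λ : Finset Γ) :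
    ℝ → ℝ → LocalAlgebra q Λ :=
  propagator T (hamiltonian Ψ Λ)

lemma continuous_embed {Z Λ : Finset Γ} (h : Z ⊆ Λ) :
    Continuous (embed (q := q) h) := by
  refine continuous_matrix fun i j => ?_
  exact (continuous_id.matrix_elem _ _).mul continuous_const

lemma continuousOn_interactionSum {T : ℝ} {Ψ : (Z : Finset Γ) → ℝ → LocalAlgebra q Z}
    (hΨ : ∀ Z, ContinuousOn (Ψ Z) (Set.Icc (-T) T)) {Λ : Finset Γ}
    (M : Finset (Finset Γ)) (hM : ∀ Z ∈ M, Z ⊆ Λ) :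
    ContinuousOn (interactionSum Ψ M hM) (Set.Icc (-T) T) :=
  continuousOn_finsetSum _ fun Z _ => (continuous_embed (hM Z.1 Z.2)).comp_continuousOn (hΨ Z.1)

/-- For a continuous interaction, `U_Λ(t,s)` is a solution of its defining equation. -/
theorem isPropagator_evolution {T : ℝ} (hT : 0 < T)
    {Ψ : (Z : Finset Γ) → ℝ → LocalAlgebra q Z}
    (hΨ : ∀ Z, ContinuousOn (Ψ Z) (Set.Icc (-T) T)) (Λ : Finset Γ) :
    IsPropagator T (hamiltonian Ψ Λ) (evolution T Ψ Λ) :=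
  isPropagator_propagator hT (continuousOn_interactionSum hΨ _
    fun _ h => Finset.mem_powerset.1 (Finset.mem_filter.1 h).1)

/-- The Schrödinger-picture evolution `σ_Λ^{t,s}(A) = U_Λ(t,s) A U_Λ(t,s)^*`. -/
def sigma (T : ℝ) (Ψ : (Z : Finset Γ) → ℝ → LocalAlgebra q Z) (Λ : Finset Γ) (t s : ℝ)
    (A : LocalAlgebra q Λ) : LocalAlgebra q Λ :=
  evolution T Ψ Λ t s * A * star (evolution T Ψ Λ t s)

/-- The sets contained in the fattened surface of width `n` that meet both `X` and `Λ \ X`. -/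
def crossingSets (G : SimpleGraph Γ) (X Λ : Finset Γ) (n : ℕ) : Finset (Finset Γ) :=
  {Y ∈ (surface G X Λ n).powerset | (Y ∩ X).Nonempty ∧ (Y ∩ (Λ \ X)).Nonempty}

/-- The surface energy `S(R,t)`, the sum of the `Ψ(Z,t)` over the sets `Z` contained in the
fattened surface of width `⌊R/2⌋` that meet both `X` and `Λ \ X`, as an operator supported
in the fattened surface of width `R`. -/
def surfaceEnergy (G : SimpleGraph Γ) (Ψ : (Z : Finset Γ) → ℝ → LocalAlgebra q Z)
    (X Λ : Finset Γ) (R : ℕ) (t : ℝ) : LocalAlgebra q (surface G X Λ R) :=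
  interactionSum Ψ (crossingSets G X Λ (R / 2))
    (fun _ h => (Finset.mem_powerset.1 (Finset.mem_filter.1 h).1).trans
      (surface_mono G X Λ (Nat.div_le_self R 2))) t

/-- `K(t)`: minus the sum of the `Ψ(Z,t)` over all `Z ⊆ Λ` that meet both `X` and `Λ \ X`. -/
def negCrossingEnergy (Ψ : (Z : Finset Γ) → ℝ → LocalAlgebra q Z) (X Λ : Finset Γ) (t : ℝ) :
    LocalAlgebra q Λ :=
  -interactionSum Ψ {Z ∈ Λ.powerset | (Z ∩ X).Nonempty ∧ (Z ∩ (Λ \ X)).Nonempty}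
    (fun _ h => Finset.mem_powerset.1 (Finset.mem_filter.1 h).1) t

/-- `Û` is a surface evolution for the factorisation with the surface operator on the left:
for `t, s ∈ [-T,T]`, it solves
`-i d/ds Û(t,s)^* = σ_{∂_R X}^{t,s}(S(R,s)) Û(t,s)^*`, `Û(t,t)^* = 1`
in the algebra of the fattened surface of width `R`. -/
def IsLeftSurfaceEvolution (G : SimpleGraph Γ) (T : ℝ)
    (Ψ : (Z : Finset Γ) → ℝ → LocalAlgebra q Z) (X Λ : Finset Γ) (R : ℕ)
    (Uhat : ℝ → ℝ → LocalAlgebra q (surface G X Λ R)) : Prop :=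
  ∀ t ∈ Set.Icc (-T) T, star (Uhat t t) = 1 ∧ ∀ s ∈ Set.Icc (-T) T,
    HasDerivWithinAt (fun r => star (Uhat t r))
      (Complex.I • (sigma T Ψ (surface G X Λ R) t s (surfaceEnergy G Ψ X Λ R s) *
        star (Uhat t s)))
      (Set.Icc (-T) T) s

end Spin

end QSpin

end

open QSpin

/-! Fix `t` and regard every evolution as a function of its second time `s`. Each then solves `dV/ds
= i V H`, `V(t) = 1` for a self-adjoint generator `H` (`IsFlow`): `U_Λ` with `H_Λ`, the decoupled
evolution with `H_X + H_{Λ∖X}`, `W` with `σ_Λ(K)` because `K = H_X + H_{Λ∖X} - H_Λ`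
(`isFlow_tensorOp_mul_star`), and `Û` with `-σ_∂(S)` (`isLeftSurfaceEvolution_iff`). Such flows are
unitary, and two of them differ by at most the integral of the norm of the difference of their
generators (`IsFlow.norm_sub_le`). Applied to `W` and `Û`, this is the integral bound.

The integrand is then estimated through `σ_Λ(K) + σ_∂(S) = σ_Λ(K + S) - (σ_Λ(S) - σ_∂(S))`. The sum
`K + S` contains, up to sign, only the crossing terms that leave the surface of width `m = ⌊R/2⌋`.
Each of them contains a pair of points, one in `X` and one outside, whose distance is bounded below
by means of the depth in `X` of the first. Since each layer of `X` has at most `|∂X|` points,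
summing over depths gives `2 ζ(m) |∂X|` times the norms of `Ψ` and `F`
(`sum_crossing_not_subset_surface_le`).

The second difference is a Lieb–Robinson estimate (`norm_conj_sub_conj_le`). The operator `S` lives
on the surface of width `m`, and the two dynamics differ only by terms leaving the surface of width
`R`. Duhamel's formula bounds the difference for one observable by the differences for the
interaction terms meeting its support. The convolution property of `F_ξ` closes this iteration, and
the remainder vanishes factorially. Both the norm of `S` and the interaction between the inner
surface and the exterior of the outer one are proportional to the cardinality of the inner surface,
whence `|∂X|²` and `m^(2D)`. -/

noncomputable section

namespace QSpin

/-! ## Unitary flows in a C⋆-algebra -/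

section Flow

variable {A : Type*} [CStarAlgebra A]

/-- `V` solves the backward equation `dV(s)/ds = i V(s) H(s)`, `V(t) = 1` on `[-T,T]`. -/
def IsFlow (T t : ℝ) (H V : ℝ → A) : Prop :=
  V t = 1 ∧ ∀ s ∈ Set.Icc (-T) T,
    HasDerivWithinAt V (Complex.I • (V s * H s)) (Set.Icc (-T) T) s

variable {T t : ℝ}

/-- The fundamental theorem of calculus for either order of `s` and `t`. Points strictly between
them are interior to `[-T,T]`, so one-sided derivatives at `±T` suffice. Keeping the integral of the
norm, rather than a supremum, is what allows Duhamel estimates to be iterated. -/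
lemma norm_sub_le_of_hasDerivWithinAt {f f' : ℝ → A}
    (hf : ∀ s ∈ Set.Icc (-T) T, HasDerivWithinAt f (f' s) (Set.Icc (-T) T) s)
    (hf' : ContinuousOn f' (Set.Icc (-T) T)) {s : ℝ}
    (ht : t ∈ Set.Icc (-T) T) (hs : s ∈ Set.Icc (-T) T) :
    ‖f s - f t‖ ≤ |∫ r in t..s, ‖f' r‖| := by
  have hsub : Set.uIcc t s ⊆ Set.Icc (-T) T := Set.uIcc_subset_Icc ht hs
  have h := intervalIntegral.integral_eq_sub_of_hasDeriv_right (f := f) (f' := f') (a := t) (b := s)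
    (fun x hx => ((hf x (hsub hx)).continuousWithinAt).mono hsub)
    (fun x hx => by
      have hx1 : x ∈ Set.uIcc t s := Set.Ioo_subset_Icc_self hx
      have hnhds : Set.Icc (-T) T ∈ nhds x :=
        Filter.mem_of_superset (Ioo_mem_nhds hx.1 hx.2) (Set.Ioo_subset_Icc_self.trans hsub)
      exact ((hf x (hsub hx1)).hasDerivAt hnhds).hasDerivWithinAt)
    ((hf'.mono hsub).intervalIntegrable)
  rw [← h]
  exact intervalIntegral.norm_integral_le_abs_integral_norm

lemma eq_of_hasDerivWithinAt_zero {f : ℝ → A}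
    (hf : ∀ s ∈ Set.Icc (-T) T, HasDerivWithinAt f 0 (Set.Icc (-T) T) s) {s : ℝ}
    (ht : t ∈ Set.Icc (-T) T) (hs : s ∈ Set.Icc (-T) T) : f s = f t := by
  have := norm_sub_le_of_hasDerivWithinAt hf continuousOn_const ht hs
  simpa [sub_eq_zero] using this

/-- Reduces an integral between `t` and `s`, in either order, to the elapsed time `u = |r - t|`,
with `G` a primitive of the bound `g`. The case `s ≤ t` is the reflected one. -/
lemma abs_integral_le_of_le_comp_abs {f g G : ℝ → ℝ} (hf : ContinuousOn f (Set.Icc (-T) T))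
    (hg : Continuous g) (hG : ∀ u, HasDerivAt G (g u) u) (hf0 : ∀ r, 0 ≤ f r)
    (ht : t ∈ Set.Icc (-T) T) {s : ℝ} (hs : s ∈ Set.Icc (-T) T)
    (hfg : ∀ r ∈ Set.Icc (-T) T, f r ≤ g |r - t|) :
    |∫ r in t..s, f r| ≤ G |s - t| - G 0 := by
  have hfi : IntervalIntegrable f MeasureTheory.volume t s :=
    (hf.mono (Set.uIcc_subset_Icc ht hs)).intervalIntegrable
  rcases le_total t s with h | h
  · rw [abs_of_nonneg (intervalIntegral.integral_nonneg h fun r _ => hf0 r),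
      abs_of_nonneg (sub_nonneg.2 h)]
    have h2 := intervalIntegral.integral_eq_sub_of_hasDerivAt (a := t) (b := s)
      (f := fun r => G (r - t)) (f' := fun r => g (r - t))
      (fun x _ => by simpa using (hG (x - t)).comp_sub_const x t)
      ((by fun_prop : Continuous fun r => g (r - t)).intervalIntegrable _ _)
    rw [sub_self] at h2
    rw [← h2]
    refine intervalIntegral.integral_mono_on h hfi
      ((by fun_prop : Continuous fun r => g (r - t)).intervalIntegrable _ _) fun r hr => ?_
    have := hfg r ⟨ht.1.trans hr.1, hr.2.trans hs.2⟩
    rwa [abs_of_nonneg (sub_nonneg.2 hr.1)] at this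
  · rw [intervalIntegral.integral_symm, abs_neg,
      abs_of_nonneg (intervalIntegral.integral_nonneg h fun r _ => hf0 r),
      abs_of_nonpos (sub_nonpos.2 h), neg_sub]
    have h2 := intervalIntegral.integral_eq_sub_of_hasDerivAt (a := s) (b := t)
      (f := fun r => -G (t - r)) (f' := fun r => g (t - r))
      (fun x _ => by simpa using ((hG (t - x)).comp_const_sub t x).fun_neg)
      ((by fun_prop : Continuous fun r => g (t - r)).intervalIntegrable _ _)
    rw [sub_self] at h2
    have h3 : G (t - s) - G 0 = -G 0 - -G (t - s) := by ring
    rw [h3, ← h2]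
    refine intervalIntegral.integral_mono_on h hfi.symm
      ((by fun_prop : Continuous fun r => g (t - r)).intervalIntegrable _ _) fun r hr => ?_
    have := hfg r ⟨hs.1.trans hr.1, hr.2.trans ht.2⟩
    rwa [abs_of_nonpos (sub_nonpos.2 hr.2), neg_sub] at this

namespace IsFlow

variable {H V : ℝ → A}

lemma continuousOn (hV : IsFlow T t H V) : ContinuousOn V (Set.Icc (-T) T) :=
  fun s hs => (hV.2 s hs).continuousWithinAt

lemma hasDerivWithinAt_star (hV : IsFlow T t H V)
    (hH : ∀ s ∈ Set.Icc (-T) T, IsSelfAdjoint (H s)) {s : ℝ} (hs : s ∈ Set.Icc (-T) T) :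
    HasDerivWithinAt (fun r => star (V r)) (-Complex.I • (H s * star (V s)))
      (Set.Icc (-T) T) s := by
  have h := (hV.2 s hs).star
  rwa [star_smul, star_mul, (hH s hs).star_eq, Complex.star_def, Complex.conj_I] at h

/-- The derivative of `V₁ B V₂⋆` along two flows. -/
lemma hasDerivWithinAt_conj {H₂ V₂ B : ℝ → A} {B' : A} (hV : IsFlow T t H V)
    (hV₂ : IsFlow T t H₂ V₂)
    (hH₂ : ∀ s ∈ Set.Icc (-T) T, IsSelfAdjoint (H₂ s)) {s : ℝ} (hs : s ∈ Set.Icc (-T) T)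
    (hB : HasDerivWithinAt B B' (Set.Icc (-T) T) s) :
    HasDerivWithinAt (fun r => V r * B r * star (V₂ r))
      (Complex.I • (V s * (H s * B s - B s * H₂ s) * star (V₂ s)) + V s * B' * star (V₂ s))
      (Set.Icc (-T) T) s := by
  have h := ((hV.2 s hs).fun_mul hB).fun_mul (hV₂.hasDerivWithinAt_star hH₂ hs)
  convert h using 1
  simp only [mul_sub, sub_mul, add_mul, smul_sub, smul_mul_assoc, mul_smul_comm, neg_smul,
    mul_neg, mul_assoc]
  abel

lemma mem_unitary [IsDedekindFiniteMonoid A] (hV : IsFlow T t H V)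
    (hH : ∀ s ∈ Set.Icc (-T) T, IsSelfAdjoint (H s)) (ht : t ∈ Set.Icc (-T) T)
    {s : ℝ} (hs : s ∈ Set.Icc (-T) T) : V s ∈ unitary A := by
  have h : V s * 1 * star (V s) = V t * 1 * star (V t) :=
    eq_of_hasDerivWithinAt_zero (f := fun r => V r * 1 * star (V r)) (fun r hr => by
      simpa using hV.hasDerivWithinAt_conj hV hH hr (hasDerivWithinAt_const r _ (1 : A))) ht hs
  rw [hV.1] at h
  have h1 : V s * star (V s) = 1 := by simpa using h
  -- Differentiation yields only `V V⋆ = 1`; the derivative of `V⋆ V` is a commutator with `H` and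
  -- need not visibly vanish. Dedekind finiteness supplies the other identity.
  exact Unitary.mem_iff.2 ⟨mul_eq_one_symm h1, h1⟩

/-- The distance of two flows is controlled by the distance of their generators. -/
lemma norm_sub_le [IsDedekindFiniteMonoid A] {H₂ V₂ : ℝ → A} (hV : IsFlow T t H V)
    (hV₂ : IsFlow T t H₂ V₂)
    (hH : ∀ s ∈ Set.Icc (-T) T, IsSelfAdjoint (H s))
    (hH₂ : ∀ s ∈ Set.Icc (-T) T, IsSelfAdjoint (H₂ s))
    (hc : ContinuousOn H (Set.Icc (-T) T)) (hc₂ : ContinuousOn H₂ (Set.Icc (-T) T))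
    (ht : t ∈ Set.Icc (-T) T) {s : ℝ} (hs : s ∈ Set.Icc (-T) T) :
    ‖V s - V₂ s‖ ≤ |∫ r in t..s, ‖H r - H₂ r‖| := by
  have hu := fun r hr => hV.mem_unitary hH ht (s := r) hr
  have hu₂ := fun r hr => hV₂.mem_unitary hH₂ ht (s := r) hr
  have h := norm_sub_le_of_hasDerivWithinAt (f := fun r => V r * 1 * star (V₂ r))
    (f' := fun r => Complex.I • (V r * (H r * 1 - 1 * H₂ r) * star (V₂ r))) (fun r hr => by
      simpa using hV.hasDerivWithinAt_conj hV₂ hH₂ hr (hasDerivWithinAt_const r _ (1 : A)))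
      (((hV.continuousOn.mul ((hc.mul continuousOn_const).sub
        (continuousOn_const.mul hc₂))).mul hV₂.continuousOn.star).const_smul _) ht hs
  -- By unitarity of `V₂`, it suffices to follow `V V₂⋆`, whose derivative `i V (H - H₂) V₂⋆` has
  -- the norm of `H - H₂`.
  have h1 : ‖V s - V₂ s‖ = ‖V s * 1 * star (V₂ s) - V t * 1 * star (V₂ t)‖ := by
    rw [← CStarRing.norm_mul_mem_unitary (V s * 1 * star (V₂ s) - V t * 1 * star (V₂ t))
      (hu₂ s hs)]
    congr 1
    simp [hV.1, hV₂.1, sub_mul, mul_assoc, Unitary.star_mul_self_of_mem (hu₂ s hs)]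
  rw [h1]
  refine h.trans_eq ?_
  congr 1
  refine intervalIntegral.integral_congr fun r hr => ?_
  have hr' := Set.uIcc_subset_Icc ht hs hr
  simp only [mul_one, one_mul, norm_smul, Complex.norm_I]
  rw [CStarRing.norm_mul_mem_unitary _ (Unitary.star_mem (hu₂ r hr')),
    CStarRing.norm_mem_unitary_mul _ (hu r hr')]

end IsFlow

/-- A propagator is a flow in its second argument. -/
lemma IsPropagator.isFlow [IsDedekindFiniteMonoid A] {H : ℝ → A} {U : ℝ → ℝ → A}
    (hU : IsPropagator T H U)
    (hH : ∀ s ∈ Set.Icc (-T) T, IsSelfAdjoint (H s)) (ht : t ∈ Set.Icc (-T) T) :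
    IsFlow T t H (U t) := by
  -- The product `U(r,s)⋆ U(r,s')` is constant in `r`. Comparing `r = t` with `r = s` gives `U(t,s)
  -- = U(s,t)⋆`, so the adjoint of the equation in the first time is an equation in the second.
  have hd : ∀ s ∈ Set.Icc (-T) T, ∀ s' ∈ Set.Icc (-T) T, ∀ r ∈ Set.Icc (-T) T,
      HasDerivWithinAt (fun r => star (U r s) * U r s') 0 (Set.Icc (-T) T) r := by
    intro s hs s' hs' r hr
    have h1 := ((hU s hs).2 r hr).star
    convert h1.fun_mul ((hU s' hs').2 r hr) using 1
    simp only [star_smul, star_mul, (hH r hr).star_eq, star_neg, Complex.star_def, Complex.conj_I,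
      neg_neg, smul_mul_assoc, neg_smul, mul_assoc]
    simp
  have hconst : ∀ s ∈ Set.Icc (-T) T, ∀ s' ∈ Set.Icc (-T) T, ∀ r ∈ Set.Icc (-T) T,
      ∀ r' ∈ Set.Icc (-T) T, star (U r s) * U r s' = star (U r' s) * U r' s' :=
    fun s hs s' hs' r hr r' hr' => eq_of_hasDerivWithinAt_zero (hd s hs s' hs') hr' hr
  have hstar : ∀ s ∈ Set.Icc (-T) T, U t s = star (U s t) := by
    intro s hs
    have h1 := hconst t ht s hs t ht s hs
    rwa [(hU t ht).1, (hU s hs).1, star_one, one_mul, mul_one] at h1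
  refine ⟨(hU t ht).1, fun s hs => ?_⟩
  have h := ((hU t ht).2 s hs).star
  simp only [star_smul, star_mul, (hH s hs).star_eq, star_neg, Complex.star_def, Complex.conj_I,
    neg_neg, ← hstar s hs] at h
  exact h.congr (fun r hr => hstar r hr) (hstar s hs)

lemma exists_isFlow [IsDedekindFiniteMonoid A] (hT : 0 < T) {H : ℝ → A}
    (hc : ContinuousOn H (Set.Icc (-T) T))
    (hH : ∀ s ∈ Set.Icc (-T) T, IsSelfAdjoint (H s)) (ht : t ∈ Set.Icc (-T) T) :
    ∃ V, IsFlow T t H V :=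
  ⟨_, (isPropagator_propagator hT hc).isFlow hH ht⟩

/-- A derivation term does not contribute to the growth of the norm. -/
lemma norm_le_of_hasDerivWithinAt_commutator [IsDedekindFiniteMonoid A] (hT : 0 < T)
    {D P E : ℝ → A}
    (hP : ContinuousOn P (Set.Icc (-T) T))
    (hPsa : ∀ s ∈ Set.Icc (-T) T, IsSelfAdjoint (P s))
    (hE : ContinuousOn E (Set.Icc (-T) T))
    (hD : ∀ s ∈ Set.Icc (-T) T,
      HasDerivWithinAt D (Complex.I • (P s * D s - D s * P s) + E s) (Set.Icc (-T) T) s)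
    (ht : t ∈ Set.Icc (-T) T) (h0 : D t = 0) {s : ℝ} (hs : s ∈ Set.Icc (-T) T) :
    ‖D s‖ ≤ |∫ r in t..s, ‖E r‖| := by
  have hsa : ∀ s ∈ Set.Icc (-T) T, IsSelfAdjoint (-P s) := fun s hs => (hPsa s hs).neg
  -- Conjugation by the flow of `-P` is isometric and cancels the commutator with `P`, leaving `Q E
  -- Q⋆` as the derivative.
  obtain ⟨Q, hQ⟩ := exists_isFlow hT (H := fun s => -P s) hP.neg hsa ht
  have hu := fun r hr => hQ.mem_unitary hsa ht (s := r) hr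
  have hn : ∀ r ∈ Set.Icc (-T) T, ∀ x : A, ‖Q r * x * star (Q r)‖ = ‖x‖ := fun r hr x => by
    rw [CStarRing.norm_mul_mem_unitary _ (Unitary.star_mem (hu r hr)),
      CStarRing.norm_mem_unitary_mul _ (hu r hr)]
  have h := norm_sub_le_of_hasDerivWithinAt (f := fun r => Q r * D r * star (Q r))
    (f' := fun r => Q r * E r * star (Q r)) (fun r hr => by
      convert hQ.hasDerivWithinAt_conj hQ hsa hr (hD r hr) using 1
      simp only [mul_sub, sub_mul, add_mul, mul_add, smul_sub, smul_mul_assoc, mul_smul_comm,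
        neg_mul, smul_neg, mul_neg, mul_assoc]
      abel)
    ((hQ.continuousOn.mul hE).mul hQ.continuousOn.star) ht hs
  rw [h0, mul_zero, zero_mul, sub_zero, hn s hs] at h
  refine h.trans_eq ?_
  congr 1
  exact intervalIntegral.integral_congr fun r hr => hn r (Set.uIcc_subset_Icc ht hs hr) _

end Flow

/-! ### Lieb–Robinson comparison of two dynamics. -/

section Locality

variable {A : Type*} [CStarAlgebra A] {T t : ℝ}

lemma norm_commutator_le (a b : A) : ‖a * b - b * a‖ ≤ 2 * (‖a‖ * ‖b‖) := by
  calc ‖a * b - b * a‖ ≤ ‖a * b‖ + ‖b * a‖ := norm_sub_le _ _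
    _ ≤ ‖a‖ * ‖b‖ + ‖b‖ * ‖a‖ := add_le_add (norm_mul_le _ _) (norm_mul_le _ _)
    _ = _ := by ring

lemma norm_conj_of_mem_unitary {V : A} (hV : V ∈ unitary A) (B : A) :
    ‖V * B * star V‖ = ‖B‖ := by
  rw [CStarRing.norm_mul_mem_unitary _ (Unitary.star_mem hV), CStarRing.norm_mem_unitary_mul _ hV]

lemma conj_commutator {V : A} (hV : V ∈ unitary A) (B C : A) :
    V * (B * C - C * B) * star V =
      V * B * star V * (V * C * star V) - V * C * star V * (V * B * star V) := by
  have h : ∀ x y : A, V * x * star V * (V * y * star V) = V * (x * y) * star V := fun x y => by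
    calc V * x * star V * (V * y * star V) = V * x * (star V * V) * y * star V := by noncomm_ring
      _ = _ := by rw [Unitary.star_mul_self_of_mem hV]; noncomm_ring
  rw [h, h, mul_sub, sub_mul]

/-- The Lieb–Robinson iteration step for the difference of the dynamics generated by `H` and `H₀`:
only the parts `G` and `L` of the generators which do not commute with `B` contribute. -/
lemma norm_conj_sub_conj_le_integral [IsDedekindFiniteMonoid A] (hT : 0 < T)
    {H H₀ G L V V₀ : ℝ → A} (hV : IsFlow T t H V) (hV₀ : IsFlow T t H₀ V₀)
    (hH : ∀ s ∈ Set.Icc (-T) T, IsSelfAdjoint (H s))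
    (hH₀ : ∀ s ∈ Set.Icc (-T) T, IsSelfAdjoint (H₀ s))
    (hG : ∀ s ∈ Set.Icc (-T) T, IsSelfAdjoint (G s))
    (hGc : ContinuousOn G (Set.Icc (-T) T)) (hLc : ContinuousOn L (Set.Icc (-T) T)) {B : A}
    (hHB : ∀ s ∈ Set.Icc (-T) T, H s * B - B * H s = (G s + L s) * B - B * (G s + L s))
    (hH₀B : ∀ s ∈ Set.Icc (-T) T, H₀ s * B - B * H₀ s = G s * B - B * G s)
    (ht : t ∈ Set.Icc (-T) T) {s : ℝ} (hs : s ∈ Set.Icc (-T) T) :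
    ‖V s * B * star (V s) - V₀ s * B * star (V₀ s)‖ ≤
      |∫ r in t..s, 2 * ‖B‖ *
        (‖V r * G r * star (V r) - V₀ r * G r * star (V₀ r)‖ + ‖L r‖)| := by
  have hu := fun r hr => hV.mem_unitary hH ht (s := r) hr
  have hu₀ := fun r hr => hV₀.mem_unitary hH₀ ht (s := r) hr
  have hVc := hV.continuousOn
  have hVc₀ := hV₀.continuousOn
  have hVs := hVc.star
  have hVs₀ := hVc₀.star
  let σ : ℝ → A → A := fun r x => V r * x * star (V r)
  let σ₀ : ℝ → A → A := fun r x => V₀ r * x * star (V₀ r)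
  -- For `D = σ(B) - σ₀(B)` one has `D' = i [σ₀(G), D] + E`: the part of `[σ(G), σ(B)] - [σ₀(G),
  -- σ₀(B)]` that is not a commutator with `D` is `[σ(G) - σ₀(G), σ(B)]`, and `L` occurs only in the
  -- full dynamics. The first term does not affect the norm bound.
  let E : ℝ → A := fun r => Complex.I •
    ((σ r (G r) - σ₀ r (G r)) * σ r B - σ r B * (σ r (G r) - σ₀ r (G r))
      + (σ r (L r) * σ r B - σ r B * σ r (L r)))
  have hE : ContinuousOn E (Set.Icc (-T) T) := by
    simp only [E, σ, σ₀]
    fun_prop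
  have hEn : ∀ r ∈ Set.Icc (-T) T,
      ‖E r‖ ≤ 2 * ‖B‖ * (‖σ r (G r) - σ₀ r (G r)‖ + ‖L r‖) := by
    intro r hr
    have h1 := norm_commutator_le (σ r (G r) - σ₀ r (G r)) (σ r B)
    have h2 := norm_commutator_le (σ r (L r)) (σ r B)
    rw [norm_conj_of_mem_unitary (hu r hr)] at h1
    rw [norm_conj_of_mem_unitary (hu r hr), norm_conj_of_mem_unitary (hu r hr)] at h2
    simp only [E, norm_smul, Complex.norm_I, one_mul]
    refine (norm_add_le _ _).trans ((add_le_add h1 h2).trans_eq ?_)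
    ring
  have key := norm_le_of_hasDerivWithinAt_commutator hT
    (D := fun r => σ r B - σ₀ r B) (P := fun r => σ₀ r (G r)) (E := E)
    (by simp only [σ₀]; fun_prop) (fun r hr => (hG r hr).conjugate _) hE
    (fun r hr => by
      refine ((hV.hasDerivWithinAt_conj hV hH hr (hasDerivWithinAt_const r _ B)).fun_sub
        (hV₀.hasDerivWithinAt_conj hV₀ hH₀ hr (hasDerivWithinAt_const r _ B))).congr_deriv ?_
      rw [hHB r hr, hH₀B r hr, conj_commutator (hu r hr), conj_commutator (hu₀ r hr)]
      simp only [E, σ, σ₀, mul_zero, zero_mul, add_zero, ← smul_add, ← smul_sub, mul_add, add_mul]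
      congr 1
      noncomm_ring)
    ht (by simp [σ, σ₀, hV.1, hV₀.1]) hs
  refine key.trans ?_
  have hsub := Set.uIcc_subset_Icc ht hs
  have hRi : IntervalIntegrable (fun r => 2 * ‖B‖ * (‖σ r (G r) - σ₀ r (G r)‖ + ‖L r‖))
      MeasureTheory.volume t s := by
    refine ContinuousOn.intervalIntegrable (ContinuousOn.mono ?_ hsub)
    simp only [σ, σ₀]
    fun_prop
  refine intervalIntegral.norm_integral_le_abs_of_norm_le
    (f := fun r => ‖E r‖) ((MeasureTheory.ae_restrict_iff' measurableSet_uIoc).2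
      (Filter.Eventually.of_forall fun r hr => ?_)) hRi
  rw [norm_norm]
  exact hEn r (hsub (Set.uIoc_subset_uIcc hr))

variable {Γ : Type*} [DecidableEq Γ]

lemma sum_commutator_eq_sum_filter {ι : Type*} (S : Finset ι) (p : ι → Prop) [DecidablePred p]
    (h : ι → A) (B : A) (hB : ∀ Z ∈ S, ¬p Z → h Z * B = B * h Z) :
    (∑ Z ∈ S, h Z) * B - B * ∑ Z ∈ S, h Z =
      (∑ Z ∈ S with p Z, h Z) * B - B * ∑ Z ∈ S with p Z, h Z := by
  rw [← Finset.sum_filter_add_sum_filter_not S p h, add_mul, mul_add]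
  have h0 : (∑ Z ∈ S with ¬p Z, h Z) * B = B * ∑ Z ∈ S with ¬p Z, h Z := by
    rw [Finset.sum_mul, Finset.mul_sum]
    refine Finset.sum_congr rfl fun Z hZ => ?_
    rw [Finset.mem_filter] at hZ
    exact hB Z hZ.1 hZ.2
  rw [h0]
  abel

/-- Finite-order form of the locality bound: after `n` iterations the remainder is that of the
exponential series with the total interaction strength. -/
lemma norm_conj_sub_conj_le_add_remainder [IsDedekindFiniteMonoid A] (hT : 0 < T)
    {S : Finset (Finset Γ)} {h : Finset Γ → ℝ → A} {φ : Finset Γ → ℝ}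
    (hc : ∀ Z ∈ S, ContinuousOn (h Z) (Set.Icc (-T) T))
    (hsa : ∀ Z ∈ S, ∀ s ∈ Set.Icc (-T) T, IsSelfAdjoint (h Z s))
    (hφ : ∀ Z ∈ S, ∀ s ∈ Set.Icc (-T) T, ‖h Z s‖ ≤ φ Z)
    (hcomm : ∀ Z ∈ S, ∀ Z' ∈ S, Disjoint Z Z' → ∀ r ∈ Set.Icc (-T) T, ∀ r' ∈ Set.Icc (-T) T,
      h Z r * h Z' r' = h Z' r' * h Z r)
    (p : Finset Γ → Prop) [DecidablePred p] {V V₀ : ℝ → A}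
    (hV : IsFlow T t (fun s => ∑ Z ∈ S, h Z s) V)
    (hV₀ : IsFlow T t (fun s => ∑ Z ∈ S with p Z, h Z s) V₀)
    {a : Finset Γ → ℝ} (ha : ∀ Y, 0 ≤ a Y) {N C : ℝ} (hN : 0 ≤ N) (hC : 0 < C)
    (hin : ∀ Y, ∑ Z ∈ S with p Z ∧ ¬Disjoint Z Y, φ Z * a Z ≤ N * (C * a Y))
    (hout : ∀ Y, ∑ Z ∈ S with ¬p Z ∧ ¬Disjoint Z Y, φ Z ≤ N * a Y)
    (ht : t ∈ Set.Icc (-T) T) (n : ℕ) (Y : Finset Γ) (B : A)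
    (hB : ∀ Z ∈ S, Disjoint Z Y → ∀ r ∈ Set.Icc (-T) T, h Z r * B = B * h Z r)
    {s : ℝ} (hs : s ∈ Set.Icc (-T) T) :
    ‖V s * B * star (V s) - V₀ s * B * star (V₀ s)‖ ≤
      ‖B‖ * (a Y / C * (Real.exp (2 * N * C * |s - t|) - 1)
        + 2 * ((2 * (∑ Z ∈ S, φ Z) * |s - t|) ^ n / n.factorial)) := by
  have hsum : ∀ (S' : Finset (Finset Γ)), S' ⊆ S → ∀ r ∈ Set.Icc (-T) T,
      IsSelfAdjoint (∑ Z ∈ S', h Z r) := fun S' hS' r hr =>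
    isSelfAdjoint_sum _ fun Z hZ => hsa Z (hS' hZ) r hr
  have hsumc : ∀ (S' : Finset (Finset Γ)), S' ⊆ S →
      ContinuousOn (fun r => ∑ Z ∈ S', h Z r) (Set.Icc (-T) T) := fun S' hS' =>
    continuousOn_finsetSum _ fun Z hZ => hc Z (hS' hZ)
  have hu := fun r hr => hV.mem_unitary (hsum S subset_rfl) ht (s := r) hr
  have hu₀ := fun r hr => hV₀.mem_unitary (hsum _ (Finset.filter_subset _ _)) ht (s := r) hr
  have hφ0 : ∀ Z ∈ S, 0 ≤ φ Z := fun Z hZ => (norm_nonneg _).trans (hφ Z hZ t ht)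
  set M := ∑ Z ∈ S, φ Z with hM
  have hM0 : 0 ≤ M := Finset.sum_nonneg hφ0
  induction n generalizing Y B s with
  | zero =>
    have h1 : ‖V s * B * star (V s) - V₀ s * B * star (V₀ s)‖ ≤ ‖B‖ + ‖B‖ := by
      refine (norm_sub_le _ _).trans_eq ?_
      rw [norm_conj_of_mem_unitary (hu s hs), norm_conj_of_mem_unitary (hu₀ s hs)]
    have h2 : 0 ≤ a Y / C * (Real.exp (2 * N * C * |s - t|) - 1) :=
      mul_nonneg (div_nonneg (ha Y) hC.le) (sub_nonneg.2 (Real.one_le_exp (by positivity)))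
    calc _ ≤ ‖B‖ + ‖B‖ := h1
      _ = ‖B‖ * (0 + 2) := by ring
      _ ≤ _ := by
        gcongr
        simp
  | succ n ih =>
    let G : ℝ → A := fun r => ∑ Z ∈ S with p Z ∧ ¬Disjoint Z Y, h Z r
    let L : ℝ → A := fun r => ∑ Z ∈ S with ¬p Z ∧ ¬Disjoint Z Y, h Z r
    have hGL : ∀ r, ∑ Z ∈ S with ¬Disjoint Z Y, h Z r = G r + L r := fun r => by
      rw [← Finset.sum_filter_add_sum_filter_not _ p, Finset.filter_filter, Finset.filter_filter]
      simp only [G, L, and_comm]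
    have hGc : ContinuousOn G (Set.Icc (-T) T) := hsumc _ (Finset.filter_subset _ _)
    have hLc : ContinuousOn L (Set.Icc (-T) T) := hsumc _ (Finset.filter_subset _ _)
    have hVc := hV.continuousOn
    have hVc₀ := hV₀.continuousOn
    have hVs := hVc.star
    have hVs₀ := hVc₀.star
    have key := norm_conj_sub_conj_le_integral hT hV hV₀ (hsum S subset_rfl)
      (hsum _ (Finset.filter_subset _ _)) (G := G) (L := L) (hsum _ (Finset.filter_subset _ _))
      hGc hLc (B := B)
      (fun r hr => by
        rw [← hGL]
        exact sum_commutator_eq_sum_filter _ _ _ _ fun Z hZ hd => hB Z hZ (not_not.1 hd) r hr)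
      (fun r hr => by
        rw [sum_commutator_eq_sum_filter _ (fun Z => ¬Disjoint Z Y) _ _ fun Z hZ hd =>
          hB Z (Finset.mem_filter.1 hZ).1 (not_not.1 hd) r hr, Finset.filter_filter])
      ht hs
    refine key.trans ?_
    -- The comparison function is the derivative of the bound claimed at order `n + 1`. In the
    -- integrand, `G` contributes `N a(Y) (e - 1) + M ρ` by induction and `L` contributes `N a(Y)`,
    -- which cancels the `-1`. The factor `2 M` is what the next term of the exponential series
    -- requires.
    have hbound := abs_integral_le_of_le_comp_abs (T := T) (t := t)
      (f := fun r => 2 * ‖B‖ *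
        (‖V r * G r * star (V r) - V₀ r * G r * star (V₀ r)‖ + ‖L r‖))
      (g := fun u => ‖B‖ * (a Y / C * (Real.exp (2 * N * C * u) * (2 * N * C))
        + 2 * (2 * M * (2 * M * u) ^ n / n.factorial)))
      (G := fun u => ‖B‖ * (a Y / C * Real.exp (2 * N * C * u)
        + 2 * ((2 * M * u) ^ (n + 1) / (n + 1).factorial)))
      (by fun_prop) (by fun_prop)
      (fun u => by
        have h1 : HasDerivAt (fun u : ℝ => 2 * N * C * u) (2 * N * C) u := by
          simpa using (hasDerivAt_id u).const_mul (2 * N * C)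
        have h2 : HasDerivAt (fun u : ℝ => 2 * M * u) (2 * M) u := by
          simpa using (hasDerivAt_id u).const_mul (2 * M)
        refine ((((h1.exp).const_mul (a Y / C)).fun_add
          ((((h2.fun_pow (n + 1))).div_const ((n + 1).factorial : ℝ)).const_mul 2)).const_mul
            ‖B‖).congr_deriv ?_
        rw [Nat.factorial_succ]
        push_cast
        have hn : (n.factorial : ℝ) ≠ 0 := by positivity
        field_simp)
      (fun r => by positivity) ht hs
      (fun r hr => by
        have hL : ‖L r‖ ≤ N * a Y := by
          refine (norm_sum_le _ _).trans ((Finset.sum_le_sum fun Z hZ => ?_).trans (hout Y))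
          exact hφ Z (Finset.mem_filter.1 hZ).1 r hr
        set e := Real.exp (2 * N * C * |r - t|) with he
        have he1 : 0 ≤ e - 1 := sub_nonneg.2 (Real.one_le_exp (by positivity))
        set ρ := 2 * ((2 * M * |r - t|) ^ n / n.factorial) with hρ
        have hρ0 : 0 ≤ ρ := by positivity
        have hG : ‖V r * G r * star (V r) - V₀ r * G r * star (V₀ r)‖
            ≤ N * a Y * (e - 1) + M * ρ := by
          have h1 : V r * G r * star (V r) - V₀ r * G r * star (V₀ r) =
              ∑ Z ∈ S with p Z ∧ ¬Disjoint Z Y,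
                (V r * h Z r * star (V r) - V₀ r * h Z r * star (V₀ r)) := by
            simp only [G, Finset.mul_sum, Finset.sum_mul, Finset.sum_sub_distrib]
          rw [h1]
          calc _ ≤ ∑ Z ∈ S with p Z ∧ ¬Disjoint Z Y, φ Z * (a Z / C * (e - 1) + ρ) := by
                refine (norm_sum_le _ _).trans (Finset.sum_le_sum fun Z hZ => ?_)
                have hZS := (Finset.mem_filter.1 hZ).1
                refine (ih Z (h Z r) (fun Z' hZ' hd r' hr' =>
                  hcomm Z' hZ' Z hZS hd r' hr' r hr) hr).trans ?_
                have h3 : 0 ≤ a Z / C * (e - 1) + ρ :=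
                  add_nonneg (mul_nonneg (div_nonneg (ha Z) hC.le) he1) hρ0
                exact mul_le_mul_of_nonneg_right (hφ Z hZS r hr) h3
            _ = (∑ Z ∈ S with p Z ∧ ¬Disjoint Z Y, φ Z * a Z) * ((e - 1) / C)
                + (∑ Z ∈ S with p Z ∧ ¬Disjoint Z Y, φ Z) * ρ := by
                rw [Finset.sum_mul, Finset.sum_mul, ← Finset.sum_add_distrib]
                exact Finset.sum_congr rfl fun Z _ => by ring
            _ ≤ N * (C * a Y) * ((e - 1) / C) + M * ρ := by
                gcongr
                · exact hin Y
                · exact Finset.sum_le_sum_of_subset_of_nonneg (Finset.filter_subset _ _)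
                    fun Z hZ _ => hφ0 Z hZ
            _ = _ := by field_simp
        calc _ ≤ 2 * ‖B‖ * (N * a Y * (e - 1) + M * ρ + N * a Y) := by gcongr
          _ = _ := by rw [hρ]; field_simp; ring)
    refine hbound.trans_eq ?_
    simp
    ring

/-- Locality of the dynamics: removing from the generator all the terms not satisfying `p` changes
the evolution of an observable supported in `Y` only by a multiple of `a Y`. -/
theorem norm_conj_sub_conj_le [IsDedekindFiniteMonoid A] (hT : 0 < T)
    {S : Finset (Finset Γ)} {h : Finset Γ → ℝ → A} {φ : Finset Γ → ℝ}
    (hc : ∀ Z ∈ S, ContinuousOn (h Z) (Set.Icc (-T) T))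
    (hsa : ∀ Z ∈ S, ∀ s ∈ Set.Icc (-T) T, IsSelfAdjoint (h Z s))
    (hφ : ∀ Z ∈ S, ∀ s ∈ Set.Icc (-T) T, ‖h Z s‖ ≤ φ Z)
    (hcomm : ∀ Z ∈ S, ∀ Z' ∈ S, Disjoint Z Z' → ∀ r ∈ Set.Icc (-T) T, ∀ r' ∈ Set.Icc (-T) T,
      h Z r * h Z' r' = h Z' r' * h Z r)
    (p : Finset Γ → Prop) [DecidablePred p] {V V₀ : ℝ → A}
    (hV : IsFlow T t (fun s => ∑ Z ∈ S, h Z s) V)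
    (hV₀ : IsFlow T t (fun s => ∑ Z ∈ S with p Z, h Z s) V₀)
    {a : Finset Γ → ℝ} (ha : ∀ Y, 0 ≤ a Y) {N C : ℝ} (hN : 0 ≤ N) (hC : 0 < C)
    (hin : ∀ Y, ∑ Z ∈ S with p Z ∧ ¬Disjoint Z Y, φ Z * a Z ≤ N * (C * a Y))
    (hout : ∀ Y, ∑ Z ∈ S with ¬p Z ∧ ¬Disjoint Z Y, φ Z ≤ N * a Y)
    (ht : t ∈ Set.Icc (-T) T) (Y : Finset Γ) (B : A)
    (hB : ∀ Z ∈ S, Disjoint Z Y → ∀ r ∈ Set.Icc (-T) T, h Z r * B = B * h Z r)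
    {s : ℝ} (hs : s ∈ Set.Icc (-T) T) :
    ‖V s * B * star (V s) - V₀ s * B * star (V₀ s)‖ ≤
      ‖B‖ * (a Y / C * (Real.exp (2 * N * C * |s - t|) - 1)) := by
  -- The family `S` is finite, so the total strength is a finite number and the remainder tends to
  -- zero; the main term does not depend on `n`.
  have hlim : Filter.Tendsto (fun n : ℕ => ‖B‖ * (a Y / C * (Real.exp (2 * N * C * |s - t|) - 1)
      + 2 * ((2 * (∑ Z ∈ S, φ Z) * |s - t|) ^ n / n.factorial))) Filter.atTop
      (nhds (‖B‖ * (a Y / C * (Real.exp (2 * N * C * |s - t|) - 1) + 2 * 0))) :=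
    ((((FloorSemiring.tendsto_pow_div_factorial_atTop _).const_mul 2).const_add _).const_mul _)
  rw [mul_zero, add_zero] at hlim
  exact ge_of_tendsto' hlim fun n => norm_conj_sub_conj_le_add_remainder hT hc hsa hφ hcomm p hV hV₀
    ha hN hC hin hout ht n Y B hB hs

end Locality

/-! ### Tensor products and embeddings of local algebras. -/

section Embedding

variable {Γ : Type*} [DecidableEq Γ] {q : Γ → ℕ}

/-- A configuration on `Λ` is a pair of configurations on `Z` and on `Λ \ Z`. -/
def splitConfig {Z Λ : Finset Γ} (h : Z ⊆ Λ) : Config q Λ ≃ Config q Z × Config q (Λ \ Z) where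
  toFun σ := (fun x => σ ⟨x, h x.2⟩, fun x => σ ⟨x, Finset.sdiff_subset x.2⟩)
  invFun τ x := if hx : x.1 ∈ Z then τ.1 ⟨x, hx⟩ else τ.2 ⟨x, Finset.mem_sdiff.2 ⟨x.2, hx⟩⟩
  left_inv σ := by
    ext x
    simp only
    split_ifs <;> rfl
  right_inv τ := by
    ext x
    · simp
    · have := (Finset.mem_sdiff.1 x.2).2
      simp [this]

/-- Up to reindexing by `splitConfig`, this is a Kronecker product, from which the algebraic laws
are inherited. -/
lemma tensorOp_eq_submatrix {Z Λ : Finset Γ} (h : Z ⊆ Λ) (A : LocalAlgebra q Z)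
    (B : LocalAlgebra q (Λ \ Z)) :
    tensorOp h A B =
      (Matrix.kroneckerMap (· * ·) A B).submatrix (splitConfig h) (splitConfig h) := rfl

lemma tensorOp_mul_tensorOp {Z Λ : Finset Γ} (h : Z ⊆ Λ) (A A' : LocalAlgebra q Z)
    (B B' : LocalAlgebra q (Λ \ Z)) :
    tensorOp h A B * tensorOp h A' B' = tensorOp h (A * A') (B * B') := by
  simp only [tensorOp_eq_submatrix, Matrix.mul_kronecker_mul, Matrix.submatrix_mul_equiv]

lemma embed_apply {Z Λ : Finset Γ} (h : Z ⊆ Λ) (A : LocalAlgebra q Z) (σ σ' : Config q Λ) :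
    embed h A σ σ' = if ∀ (x : Γ) (hx : x ∈ Λ), x ∉ Z → σ ⟨x, hx⟩ = σ' ⟨x, hx⟩ then
      A (fun x => σ ⟨x, h x.2⟩) (fun x => σ' ⟨x, h x.2⟩) else 0 := by
  simp only [embed, tensorOp, Matrix.of_apply, Matrix.one_apply, mul_ite, mul_one, mul_zero]
  refine if_congr ?_ rfl rfl
  rw [funext_iff]
  constructor
  · exact fun H x hx hxZ => H ⟨x, Finset.mem_sdiff.2 ⟨hx, hxZ⟩⟩
  · exact fun H x => H x _ (Finset.mem_sdiff.1 x.2).2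

/-- The embedding of local algebras as a homomorphism of star algebras. -/
def embedHom {Z Λ : Finset Γ} (h : Z ⊆ Λ) : LocalAlgebra q Z →⋆ₐ[ℂ] LocalAlgebra q Λ where
  toFun := embed h
  map_one' := by
    simp only [embed, tensorOp_eq_submatrix, Matrix.one_kronecker_one, Matrix.submatrix_one_equiv]
  map_mul' A B := by simp only [embed, tensorOp_mul_tensorOp, mul_one]
  map_zero' := by ext; simp [embed, tensorOp]
  map_add' A B := by ext; simp [embed, tensorOp, add_mul]
  commutes' c := by
    ext σ σ'
    have h1 : (1 : LocalAlgebra q Λ) = embed h 1 := by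
      simp only [embed, tensorOp_eq_submatrix, Matrix.one_kronecker_one,
        Matrix.submatrix_one_equiv]
    rw [Algebra.algebraMap_eq_smul_one, Algebra.algebraMap_eq_smul_one, h1]
    simp only [embed, tensorOp, Matrix.of_apply, Matrix.smul_apply, smul_eq_mul, mul_assoc]
  map_star' A := by
    ext σ σ'
    simp only [embed_apply, Matrix.star_apply, apply_ite star, star_zero]
    refine if_congr ?_ rfl rfl
    simp only [eq_comm]

@[simp] lemma embedHom_apply {Z Λ : Finset Γ} (h : Z ⊆ Λ) (A : LocalAlgebra q Z) :
    embedHom h A = embed h A := rfl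

lemma norm_embed_le {Z Λ : Finset Γ} (h : Z ⊆ Λ) (A : LocalAlgebra q Z) : ‖embed h A‖ ≤ ‖A‖ :=
  NonUnitalStarAlgHom.norm_apply_le (embedHom h) A

lemma embed_embed {Z Y Λ : Finset Γ} (h : Z ⊆ Y) (h' : Y ⊆ Λ) (A : LocalAlgebra q Z) :
    embed h' (embed h A) = embed (h.trans h') A := by
  ext σ σ'
  simp only [embed_apply]
  rw [← ite_and]
  refine if_congr ⟨fun H x hx hxZ => ?_, fun H => ⟨fun x hx hxY => H x hx fun hz => hxY (h hz),
    fun x hx hxZ => H x (h' hx) hxZ⟩⟩ rfl rfl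
  by_cases hxY : x ∈ Y
  · exact H.2 x hxY hxZ
  · exact H.1 x hx hxY

lemma embed_sdiff {Z Λ : Finset Γ} (h : Z ⊆ Λ) (B : LocalAlgebra q (Λ \ Z)) :
    embed Finset.sdiff_subset B = tensorOp h 1 B := by
  ext σ σ'
  simp only [embed_apply, tensorOp, Matrix.of_apply, Matrix.one_apply, ite_mul, one_mul, zero_mul]
  refine if_congr ?_ rfl rfl
  rw [funext_iff]
  constructor
  · exact fun H x => H x _ fun hx => (Finset.mem_sdiff.1 hx).2 x.2
  · intro H x hx hx'
    exact H ⟨x, by_contra fun hxZ => hx' (Finset.mem_sdiff.2 ⟨hx, hxZ⟩)⟩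

lemma tensorOp_eq_mul {Z Λ : Finset Γ} (h : Z ⊆ Λ) (A : LocalAlgebra q Z)
    (B : LocalAlgebra q (Λ \ Z)) :
    tensorOp h A B = embed h A * embed Finset.sdiff_subset B := by
  rw [embed_sdiff h, embed, tensorOp_mul_tensorOp, mul_one, one_mul]

/-- Since `Z'` lies in `Λ \ Z`, the second operator factors through that algebra, and the two become
`A ⊗ 1` and `1 ⊗ B`. -/
lemma commute_embed_of_disjoint {Z Z' Λ : Finset Γ} (h : Z ⊆ Λ) (h' : Z' ⊆ Λ)
    (hd : Disjoint Z Z') (A : LocalAlgebra q Z) (B : LocalAlgebra q Z') :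
    Commute (embed h A) (embed h' B) := by
  have hs : Z' ⊆ Λ \ Z := Finset.subset_sdiff.2 ⟨h', hd.symm⟩
  rw [← embed_embed hs Finset.sdiff_subset, embed_sdiff h, embed, Commute, SemiconjBy,
    tensorOp_mul_tensorOp, tensorOp_mul_tensorOp]
  simp only [mul_one, one_mul]

/-- The interaction term `Ψ(Z,t)` as an operator in the volume `Λ` (zero unless `Z ⊆ Λ`). -/
def termIn (Ψ : (Z : Finset Γ) → ℝ → LocalAlgebra q Z) (Λ Z : Finset Γ) (t : ℝ) :
    LocalAlgebra q Λ :=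
  if h : Z ⊆ Λ then embed h (Ψ Z t) else 0

variable {Ψ : (Z : Finset Γ) → ℝ → LocalAlgebra q Z} {T : ℝ}

lemma termIn_of_subset {Λ Z : Finset Γ} (h : Z ⊆ Λ) (t : ℝ) :
    termIn Ψ Λ Z t = embed h (Ψ Z t) := dif_pos h

lemma interactionSum_eq {Λ : Finset Γ} (M : Finset (Finset Γ)) (hM : ∀ Z ∈ M, Z ⊆ Λ) (t : ℝ) :
    interactionSum Ψ M hM t = ∑ Z ∈ M, termIn Ψ Λ Z t := by
  rw [interactionSum, ← Finset.sum_attach M]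
  exact Finset.sum_congr rfl fun Z _ => (termIn_of_subset (hM Z.1 Z.2) t).symm

lemma embed_interactionSum {Y Λ : Finset Γ} (h : Y ⊆ Λ) (M : Finset (Finset Γ))
    (hM : ∀ Z ∈ M, Z ⊆ Y) (t : ℝ) :
    embed h (interactionSum Ψ M hM t) = ∑ Z ∈ M, termIn Ψ Λ Z t := by
  rw [interactionSum, ← Finset.sum_attach M, ← embedHom_apply, map_sum]
  refine Finset.sum_congr rfl fun Z _ => ?_
  rw [embedHom_apply, embed_embed, termIn_of_subset]

lemma isSelfAdjoint_interactionSum (hΨ : ∀ Z, ∀ t ∈ Set.Icc (-T) T, IsSelfAdjoint (Ψ Z t))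
    {Λ : Finset Γ} (M : Finset (Finset Γ)) (hM : ∀ Z ∈ M, Z ⊆ Λ) {t : ℝ}
    (ht : t ∈ Set.Icc (-T) T) : IsSelfAdjoint (interactionSum Ψ M hM t) :=
  isSelfAdjoint_sum _ fun Z _ => (hΨ Z.1 t ht).map (embedHom (hM Z.1 Z.2))

lemma isSelfAdjoint_termIn (hΨ : ∀ Z, ∀ t ∈ Set.Icc (-T) T, IsSelfAdjoint (Ψ Z t))
    (Λ Z : Finset Γ) {t : ℝ} (ht : t ∈ Set.Icc (-T) T) : IsSelfAdjoint (termIn Ψ Λ Z t) := by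
  rw [termIn]
  split_ifs with h
  · exact (hΨ Z t ht).map (embedHom h)
  · exact IsSelfAdjoint.zero _

lemma continuousOn_termIn (hΨ : ∀ Z, ContinuousOn (Ψ Z) (Set.Icc (-T) T)) (Λ Z : Finset Γ) :
    ContinuousOn (termIn Ψ Λ Z) (Set.Icc (-T) T) := by
  by_cases h : Z ⊆ Λ
  · exact ((continuous_embed h).comp_continuousOn (hΨ Z)).congr fun t _ => termIn_of_subset h t
  · exact continuousOn_const.congr fun t _ => dif_neg h

lemma norm_termIn_le (Λ Z : Finset Γ) (t : ℝ) : ‖termIn Ψ Λ Z t‖ ≤ ‖Ψ Z t‖ := by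
  rw [termIn]
  split_ifs with h
  · exact norm_embed_le h _
  · simp

lemma commute_termIn_of_disjoint (Λ : Finset Γ) {Z Z' : Finset Γ} (hd : Disjoint Z Z')
    (t t' : ℝ) : Commute (termIn Ψ Λ Z t) (termIn Ψ Λ Z' t') := by
  rw [termIn, termIn]
  split_ifs with h h'
  · exact commute_embed_of_disjoint h h' hd _ _
  · exact Commute.zero_right _
  · exact Commute.zero_left _
  · exact Commute.zero_right _

/-- The Hamiltonian of `Λ` is the sum of those of `X` and `Λ \ X` and of the crossing terms. -/
lemma hamiltonian_split {X Λ : Finset Γ} (h : X ⊆ Λ) (t : ℝ) :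
    embed h (hamiltonian Ψ X t) + embed Finset.sdiff_subset (hamiltonian Ψ (Λ \ X) t)
      - hamiltonian Ψ Λ t = negCrossingEnergy Ψ X Λ t := by
  rw [hamiltonian, hamiltonian, hamiltonian, negCrossingEnergy, embed_interactionSum,
    embed_interactionSum, interactionSum_eq, interactionSum_eq, sub_eq_iff_eq_add, neg_add_eq_sub,
    eq_sub_iff_add_eq]
  -- Nonemptiness matters here: the empty set would be counted in both volumes.
  have hd1 : Disjoint {Z ∈ X.powerset | Z.Nonempty} {Z ∈ (Λ \ X).powerset | Z.Nonempty} := by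
    rw [Finset.disjoint_left]
    simp only [Finset.mem_filter, Finset.mem_powerset]
    rintro Z ⟨h1, x, hx⟩ ⟨h2, -⟩
    exact (Finset.mem_sdiff.1 (h2 hx)).2 (h1 hx)
  have hd2 : Disjoint ({Z ∈ X.powerset | Z.Nonempty} ∪ {Z ∈ (Λ \ X).powerset | Z.Nonempty})
      {Z ∈ Λ.powerset | (Z ∩ X).Nonempty ∧ (Z ∩ (Λ \ X)).Nonempty} := by
    rw [Finset.disjoint_left]
    simp only [Finset.mem_union, Finset.mem_filter, Finset.mem_powerset]
    rintro Z (⟨h1, -⟩ | ⟨h1, -⟩) ⟨-, ⟨x, hx⟩, ⟨y, hy⟩⟩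
    · simp only [Finset.mem_inter, Finset.mem_sdiff] at hy
      exact hy.2.2 (h1 hy.1)
    · simp only [Finset.mem_inter] at hx
      exact (Finset.mem_sdiff.1 (h1 hx.1)).2 hx.2
  rw [← Finset.sum_union hd1, ← Finset.sum_union hd2]
  refine Finset.sum_congr ?_ fun _ _ => rfl
  ext Z
  simp only [Finset.mem_union, Finset.mem_filter, Finset.mem_powerset]
  constructor
  · rintro ((⟨h1, h2⟩ | ⟨h1, h2⟩) | ⟨h1, ⟨x, hx⟩, -⟩)
    · exact ⟨h1.trans h, h2⟩
    · exact ⟨h1.trans Finset.sdiff_subset, h2⟩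
    · exact ⟨h1, x, (Finset.mem_inter.1 hx).1⟩
  · rintro ⟨h1, h2⟩
    by_cases hX : Z ⊆ X
    · exact .inl (.inl ⟨hX, h2⟩)
    by_cases hX' : Z ⊆ Λ \ X
    · exact .inl (.inr ⟨hX', h2⟩)
    obtain ⟨y, hy, hyX⟩ := Finset.not_subset.1 hX
    obtain ⟨x, hx, hxX⟩ := Finset.not_subset.1 hX'
    refine .inr ⟨h1, ⟨x, ?_⟩, ⟨y, ?_⟩⟩
    · simp only [Finset.mem_sdiff, not_and, not_not] at hxX
      exact Finset.mem_inter.2 ⟨hx, hxX (h1 hx)⟩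
    · exact Finset.mem_inter.2 ⟨hy, Finset.mem_sdiff.2 ⟨h1 hy, hyX⟩⟩

end Embedding

/-! ### Finite-sum forms of the decay constants. -/

section DecayBounds

variable {Γ : Type*} {G : SimpleGraph Γ}

lemma sum_le_toReal_decayNorm {F : ℝ → ℝ} (hF : ∀ r, 0 ≤ r → 0 < F r)
    (hF_norm : decayNorm G F < ⊤) (x : Γ) (s : Finset Γ) :
    ∑ y ∈ s, F (G.dist x y) ≤ (decayNorm G F).toReal := by
  rw [← ENNReal.ofReal_le_iff_le_toReal hF_norm.ne,
    ENNReal.ofReal_sum_of_nonneg fun y _ => (hF _ (Nat.cast_nonneg _)).le]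
  exact (ENNReal.sum_le_tsum s).trans
    (le_iSup (fun x => ∑' y : Γ, ENNReal.ofReal (F (G.dist x y))) x)

lemma sum_mul_le_toReal_convConst {F : ℝ → ℝ} (hF : ∀ r, 0 ≤ r → 0 < F r)
    (hF_conv : convConst G F < ⊤) (x z : Γ) (s : Finset Γ) :
    ∑ y ∈ s, F (G.dist x y) * F (G.dist y z) ≤ (convConst G F).toReal * F (G.dist x z) := by
  have hp : ∀ a b : Γ, 0 < F (G.dist a b) := fun a b => hF _ (Nat.cast_nonneg _)
  rw [← div_le_iff₀ (hp x z), Finset.sum_div, ← ENNReal.ofReal_le_iff_le_toReal hF_conv.ne,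
    ENNReal.ofReal_sum_of_nonneg fun y _ =>
      (div_pos (mul_pos (hp x y) (hp y z)) (hp x z)).le]
  exact (ENNReal.sum_le_tsum s).trans (le_iSup₂ (f := fun x z => ∑' y : Γ,
    ENNReal.ofReal (F (G.dist x y) * F (G.dist y z) / F (G.dist x z))) x z)

/-- Taking all three points equal gives `F(0)² ≤ C_F F(0)`, hence `C_F ≥ F(0) > 0`. -/
lemma toReal_convConst_pos {F : ℝ → ℝ} (hF : ∀ r, 0 ≤ r → 0 < F r)
    (hF_conv : convConst G F < ⊤) (x : Γ) : 0 < (convConst G F).toReal := by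
  have h := sum_mul_le_toReal_convConst hF hF_conv x x {x}
  have hp : 0 < F (G.dist x x) := hF _ (Nat.cast_nonneg _)
  rw [Finset.sum_singleton] at h
  exact hp.trans_le (le_of_mul_le_mul_right h hp)

variable {F ξ : ℝ → ℝ}

lemma le_one_of_mul_le_add (hξ_pos : ∀ r, 0 ≤ r → 0 < ξ r)
    (hξ_anti : AntitoneOn ξ (Set.Ici 0))
    (hξ_super : ∀ a b, 0 ≤ a → 0 ≤ b → ξ a * ξ b ≤ ξ (a + b)) {r : ℝ} (hr : 0 ≤ r) :
    ξ r ≤ 1 := by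
  have h := hξ_super 0 0 le_rfl le_rfl
  rw [add_zero] at h
  have h0 : ξ 0 ≤ 1 := le_of_mul_le_mul_right (by rwa [one_mul]) (hξ_pos 0 le_rfl)
  exact (hξ_anti Set.self_mem_Ici hr hr).trans h0

lemma decayNorm_mul_lt_top (hF_pos : ∀ r, 0 ≤ r → 0 < F r) (hF_norm : decayNorm G F < ⊤)
    (hξ_pos : ∀ r, 0 ≤ r → 0 < ξ r) (hξ_anti : AntitoneOn ξ (Set.Ici 0))
    (hξ_super : ∀ a b, 0 ≤ a → 0 ≤ b → ξ a * ξ b ≤ ξ (a + b)) :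
    decayNorm G (fun r => F r * ξ r) < ⊤ := by
  refine lt_of_le_of_lt (iSup_mono fun x => ENNReal.tsum_le_tsum fun y => ?_) hF_norm
  exact ENNReal.ofReal_le_ofReal (mul_le_of_le_one_right (hF_pos _ (Nat.cast_nonneg _)).le
    (le_one_of_mul_le_add hξ_pos hξ_anti hξ_super (Nat.cast_nonneg _)))

/-- The triangle inequality, monotonicity and supermultiplicativity give `ξ(d(x,y)) ξ(d(y,z)) ≤
ξ(d(x,z))`, so each summand is at most the one for `F`. Finiteness is essential, as `toReal` sends
`⊤` to `0`. -/
lemma convConst_mul_lt_top (hG : G.Connected) (hF_pos : ∀ r, 0 ≤ r → 0 < F r)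
    (hF_conv : convConst G F < ⊤)
    (hξ_pos : ∀ r, 0 ≤ r → 0 < ξ r) (hξ_anti : AntitoneOn ξ (Set.Ici 0))
    (hξ_super : ∀ a b, 0 ≤ a → 0 ≤ b → ξ a * ξ b ≤ ξ (a + b)) :
    convConst G (fun r => F r * ξ r) < ⊤ := by
  refine lt_of_le_of_lt (iSup₂_mono fun x z => ENNReal.tsum_le_tsum fun y => ?_) hF_conv
  refine ENNReal.ofReal_le_ofReal ?_
  have hp : ∀ a b : Γ, 0 < F (G.dist a b) := fun a b => hF_pos _ (Nat.cast_nonneg _)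
  have hq : ∀ a b : Γ, 0 < ξ (G.dist a b) := fun a b => hξ_pos _ (Nat.cast_nonneg _)
  have h : ξ (G.dist x y) * ξ (G.dist y z) ≤ ξ (G.dist x z) := by
    refine (hξ_super _ _ (Nat.cast_nonneg _) (Nat.cast_nonneg _)).trans
      (hξ_anti (Set.mem_Ici.2 (Nat.cast_nonneg _))
        (Set.mem_Ici.2 (add_nonneg (Nat.cast_nonneg _) (Nat.cast_nonneg _))) ?_)
    exact_mod_cast hG.dist_triangle
  rw [div_le_div_iff₀ (mul_pos (hp x z) (hq x z)) (hp x z)]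
  calc F (G.dist x y) * ξ (G.dist x y) * (F (G.dist y z) * ξ (G.dist y z)) * F (G.dist x z)
      = F (G.dist x y) * F (G.dist y z) * F (G.dist x z)
        * (ξ (G.dist x y) * ξ (G.dist y z)) := by ring
    _ ≤ F (G.dist x y) * F (G.dist y z) * F (G.dist x z) * ξ (G.dist x z) :=
      mul_le_mul_of_nonneg_left h (mul_pos (mul_pos (hp x y) (hp y z)) (hp x z)).le
    _ = _ := by ring

/-- The case `n = 2` of the decay hypothesis suffices: `ξ(k) = O(k⁻²)`. -/
lemma summable_nat_of_decay
    (hξ_decay : ∀ n : ℕ, Filter.Tendsto (fun r : ℝ => ξ r * r ^ n) Filter.atTop (nhds 0)) :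
    Summable fun k : ℕ => ξ k := by
  refine summable_of_isBigO_nat (g := fun k : ℕ => ((k : ℝ) ^ 2)⁻¹)
    (Real.summable_nat_pow_inv.2 one_lt_two) ?_
  have h := ((hξ_decay 2).comp tendsto_natCast_atTop_atTop).isBigO_one ℝ
  have h2 := h.mul (Asymptotics.isBigO_refl (fun k : ℕ => ((k : ℝ) ^ 2)⁻¹) Filter.atTop)
  refine (h2.congr' ?_ ?_)
  · filter_upwards [Filter.eventually_ge_atTop 1] with k hk
    have : (k : ℝ) ≠ 0 := by positivity
    simp [this]
  · exact Filter.Eventually.of_forall fun k => by simp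

end DecayBounds

/-! ### Summation of interaction strengths over pairs of points. -/

section InteractionBounds

variable {Γ : Type*} [DecidableEq Γ] {q : Γ → ℕ} {G : SimpleGraph Γ} {T : ℝ}
  {Ψ : (Z : Finset Γ) → ℝ → LocalAlgebra q Z}

/-- The maximal strength `sup_{t ∈ [-T,T]} ‖Ψ(Z,t)‖` of an interaction term. -/
def strength (T : ℝ) (Ψ : (Z : Finset Γ) → ℝ → LocalAlgebra q Z) (Z : Finset Γ) : ℝ :=
  (⨆ t ∈ Set.Icc (-T) T, ENNReal.ofReal ‖Ψ Z t‖).toReal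

lemma strength_nonneg (Z : Finset Γ) : 0 ≤ strength T Ψ Z := ENNReal.toReal_nonneg

lemma iSup_ofReal_norm_lt_top (hΨ : ∀ Z, ContinuousOn (Ψ Z) (Set.Icc (-T) T)) (Z : Finset Γ) :
    ⨆ t ∈ Set.Icc (-T) T, ENNReal.ofReal ‖Ψ Z t‖ < ⊤ := by
  obtain ⟨M, hM⟩ := isCompact_Icc.exists_bound_of_continuousOn (hΨ Z)
  exact (iSup₂_le fun t ht => ENNReal.ofReal_le_ofReal (hM t ht)).trans_lt ENNReal.ofReal_lt_top

lemma norm_le_strength (hΨ : ∀ Z, ContinuousOn (Ψ Z) (Set.Icc (-T) T)) (Z : Finset Γ) {t : ℝ}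
    (ht : t ∈ Set.Icc (-T) T) : ‖Ψ Z t‖ ≤ strength T Ψ Z := by
  rw [strength, ← ENNReal.ofReal_le_iff_le_toReal (iSup_ofReal_norm_lt_top hΨ Z).ne]
  exact le_iSup₂ (f := fun t (_ : t ∈ Set.Icc (-T) T) => ENNReal.ofReal ‖Ψ Z t‖) t ht

lemma sum_strength_le {F : ℝ → ℝ} (hF : ∀ r, 0 ≤ r → 0 < F r)
    (hΨ : ∀ Z, ContinuousOn (Ψ Z) (Set.Icc (-T) T))
    (hΨ_norm : interactionNorm G F T Ψ < ⊤) (S : Finset (Finset Γ)) (x y : Γ) :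
    ∑ Z ∈ S with x ∈ Z ∧ y ∈ Z, strength T Ψ Z
      ≤ (interactionNorm G F T Ψ).toReal * F (G.dist x y) := by
  have hp : 0 < F (G.dist x y) := hF _ (Nat.cast_nonneg _)
  rw [← div_le_iff₀ hp, ← ENNReal.ofReal_le_iff_le_toReal hΨ_norm.ne, div_eq_inv_mul,
    ← one_div, ENNReal.ofReal_mul (one_div_pos.2 hp).le,
    ENNReal.ofReal_sum_of_nonneg fun Z _ => strength_nonneg Z]
  refine le_trans ?_ (le_iSup₂ (f := fun x y => ENNReal.ofReal (1 / F (G.dist x y)) *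
    ∑' Z : {Z : Finset Γ // x ∈ Z ∧ y ∈ Z},
      ⨆ t ∈ Set.Icc (-T) T, ENNReal.ofReal ‖Ψ Z.1 t‖) x y)
  gcongr
  rw [← Finset.sum_subtype_eq_sum_filter]
  refine (Finset.sum_le_sum fun Z _ => ?_).trans (ENNReal.sum_le_tsum _)
  rw [strength, ENNReal.ofReal_toReal (iSup_ofReal_norm_lt_top hΨ Z).ne]

/-- If every set of `S` contains one of the pairs in `P`, then the total strength of `S` is bounded
by the sum over the pairs. -/
lemma sum_le_sum_pairs {φ : Finset Γ → ℝ} (hφ : ∀ Z, 0 ≤ φ Z) {f : Γ → Γ → ℝ}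
    (S : Finset (Finset Γ)) (hf : ∀ x y, ∑ Z ∈ S with x ∈ Z ∧ y ∈ Z, φ Z ≤ f x y)
    (P : Finset (Γ × Γ)) (hP : ∀ Z ∈ S, ∃ p ∈ P, p.1 ∈ Z ∧ p.2 ∈ Z) :
    ∑ Z ∈ S, φ Z ≤ ∑ p ∈ P, f p.1 p.2 := by
  calc ∑ Z ∈ S, φ Z ≤ ∑ Z ∈ S, ∑ p ∈ P, if p.1 ∈ Z ∧ p.2 ∈ Z then φ Z else 0 := by
        refine Finset.sum_le_sum fun Z hZ => ?_
        obtain ⟨p, hp, h⟩ := hP Z hZ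
        refine le_trans (by rw [if_pos h]) (Finset.single_le_sum
          (f := fun p : Γ × Γ => if p.1 ∈ Z ∧ p.2 ∈ Z then φ Z else 0) (fun p _ => ?_) hp)
        split_ifs
        exacts [hφ Z, le_rfl]
    _ = ∑ p ∈ P, ∑ Z ∈ S with p.1 ∈ Z ∧ p.2 ∈ Z, φ Z := by
        rw [Finset.sum_comm]
        exact Finset.sum_congr rfl fun p _ => (Finset.sum_filter _ _).symm
    _ ≤ _ := Finset.sum_le_sum fun p _ => hf p.1 p.2

/-- The convolution estimate for sums over the sets meeting `Y`. -/
lemma sum_mul_sum_le {φ : Finset Γ → ℝ} (hφ : ∀ Z, 0 ≤ φ Z) {f : Γ → Γ → ℝ} {N C : ℝ}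
    (hN : 0 ≤ N) (hf0 : ∀ x y, 0 ≤ f x y)
    (S : Finset (Finset Γ)) (hf : ∀ x y, ∑ Z ∈ S with x ∈ Z ∧ y ∈ Z, φ Z ≤ N * f x y)
    (Λ : Finset Γ) (hS : ∀ Z ∈ S, Z ⊆ Λ)
    (hconv : ∀ x z, ∑ w ∈ Λ, f x w * f w z ≤ C * f x z)
    (Y B : Finset Γ) (hY : ∀ Z ∈ S, ¬Disjoint Z Y) :
    ∑ Z ∈ S, φ Z * ∑ w ∈ Z, ∑ z ∈ B, f w z ≤ N * (C * ∑ x ∈ Y, ∑ z ∈ B, f x z) := by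
  set b : Γ → ℝ := fun w => ∑ z ∈ B, f w z with hb
  have hb0 : ∀ w, 0 ≤ b w := fun w => Finset.sum_nonneg fun z _ => hf0 w z
  -- Every `Z` meets `Y` in some `x`, so each `w ∈ Z` forms a pair `x, w` in `Z`. Summing `φ` over
  -- the sets containing this pair produces `N f(x,w)`, which then convolves with `f(w,z)`.
  calc ∑ Z ∈ S, φ Z * ∑ w ∈ Z, b w
      ≤ ∑ Z ∈ S, ∑ x ∈ Y, ∑ w ∈ Λ, if x ∈ Z ∧ w ∈ Z then φ Z * b w else 0 := by
        refine Finset.sum_le_sum fun Z hZ => ?_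
        obtain ⟨x, hxZ, hxY⟩ := Finset.not_disjoint_iff.1 (hY Z hZ)
        have h0 : ∀ x w, 0 ≤ if x ∈ Z ∧ w ∈ Z then φ Z * b w else 0 := fun x w => by
          split_ifs
          exacts [mul_nonneg (hφ Z) (hb0 w), le_rfl]
        refine le_trans ?_ (Finset.single_le_sum
          (f := fun x => ∑ w ∈ Λ, if x ∈ Z ∧ w ∈ Z then φ Z * b w else 0)
          (fun x _ => Finset.sum_nonneg fun w _ => h0 x w) hxY)
        simp only [hxZ, true_and]
        rw [← Finset.sum_filter, Finset.filter_mem_eq_inter, Finset.inter_eq_right.2 (hS Z hZ),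
          Finset.mul_sum]
    _ = ∑ x ∈ Y, ∑ w ∈ Λ, (∑ Z ∈ S with x ∈ Z ∧ w ∈ Z, φ Z) * b w := by
        rw [Finset.sum_comm]
        refine Finset.sum_congr rfl fun x _ => ?_
        rw [Finset.sum_comm]
        refine Finset.sum_congr rfl fun w _ => ?_
        rw [Finset.sum_mul, Finset.sum_filter]
    _ ≤ ∑ x ∈ Y, ∑ w ∈ Λ, N * f x w * b w := by
        gcongr with x _ w _
        · exact hb0 w
        · exact hf x w
    _ = N * ∑ x ∈ Y, ∑ z ∈ B, ∑ w ∈ Λ, f x w * f w z := by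
        simp only [hb, Finset.mul_sum]
        refine Finset.sum_congr rfl fun x _ => ?_
        rw [Finset.sum_comm]
        refine Finset.sum_congr rfl fun z _ => Finset.sum_congr rfl fun w _ => by ring
    _ ≤ N * ∑ x ∈ Y, ∑ z ∈ B, C * f x z := by
        gcongr with x _ z _
        exact hconv x z
    _ = _ := by simp only [hb, Finset.mul_sum]

end InteractionBounds

/-! ### Depth inside `X` and the size of its layers. -/

section Layers

variable {Γ : Type*} {G : SimpleGraph Γ} {X : Finset Γ}

/-- The distance from a point to the complement of `X`. -/
def depth (G : SimpleGraph Γ) (X : Finset Γ) (x : Γ) : ℕ := sInf {k | ∃ y ∉ X, G.dist x y = k}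

lemma depth_le {x y : Γ} (hy : y ∉ X) : depth G X x ≤ G.dist x y := Nat.sInf_le ⟨y, hy, rfl⟩

/-- A point outside `X` makes the infimum attained; without one, `depth` takes the default value
`0`. -/
lemma exists_dist_eq_depth {y₀ : Γ} (hy₀ : y₀ ∉ X) (x : Γ) :
    ∃ y ∉ X, G.dist x y = depth G X x :=
  Nat.sInf_mem (s := {k | ∃ y ∉ X, G.dist x y = k}) ⟨_, y₀, hy₀, rfl⟩

lemma depth_pos (hG : G.Connected) {y₀ : Γ} (hy₀ : y₀ ∉ X) {x : Γ} (hx : x ∈ X) :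
    0 < depth G X x := by
  obtain ⟨y, hy, h⟩ := exists_dist_eq_depth (G := G) hy₀ x
  rw [← h]
  exact hG.pos_dist_of_ne fun e => hy (e ▸ hx)

/-- A path from `x ∈ X` to a point at distance more than `m` from `X` first has to leave `X`. -/
lemma add_depth_le_length (hG : G.Connected) {m : ℕ} {x z : Γ} (p : G.Walk x z) (hx : x ∈ X)
    (hz : ∀ x' ∈ X, m + 1 ≤ G.dist x' z) : m + depth G X x ≤ p.length := by
  induction p with
  | nil => simpa using hz _ hx
  | @cons u v w h p ih =>
    by_cases hv : v ∈ X
    · have hw : w ∉ X := fun hw => by simpa using hz w hw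
      obtain ⟨y, hy, hvy⟩ := exists_dist_eq_depth (G := G) hw v
      have h1 := depth_le (G := G) (x := u) hy
      have h2 : G.dist u y ≤ G.dist u v + G.dist v y := hG.dist_triangle
      have h3 : G.dist u v = 1 := SimpleGraph.dist_eq_one_iff_adj.2 h
      have h4 := ih hv hz
      rw [SimpleGraph.Walk.length_cons]
      omega
    -- The path leaves `X` along this edge: `u` has depth at most one and is still at distance at
    -- least `m + 1` from the endpoint. The exit edge serves both bounds, hence `m` rather than `m +
    -- 1` in the conclusion.
    · have h1 := depth_le (G := G) (x := u) hv
      have h3 : G.dist u v = 1 := SimpleGraph.dist_eq_one_iff_adj.2 h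
      have h4 := SimpleGraph.dist_le (SimpleGraph.Walk.cons h p)
      have h5 := hz u hx
      omega

lemma add_depth_le_dist (hG : G.Connected) {m : ℕ} {x z : Γ} (hx : x ∈ X)
    (hz : ∀ x' ∈ X, m + 1 ≤ G.dist x' z) : m + depth G X x ≤ G.dist x z := by
  obtain ⟨p, hp⟩ := hG.exists_walk_length_eq_dist x z
  exact hp ▸ add_depth_le_length hG p hx hz

lemma layer_subset (k : ℕ) : layer G X k ⊆ X := fun x hx => by
  by_contra h
  exact hx.2 ⟨x, h, by simp⟩

/-- The points of depth `k` lie in the layer `k`, which is no larger than the layer `1`, and the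
latter is contained in the inner boundary. -/
lemma card_filter_depth_le [DecidableEq Γ] {y₀ : Γ} (hy₀ : y₀ ∉ X)
    (hX : ∀ m n : ℕ, 1 ≤ m → m ≤ n → (layer G X n).ncard ≤ (layer G X m).ncard) {k : ℕ}
    (hk : 1 ≤ k) : (X.filter fun x => depth G X x = k).card ≤ (innerBoundary G X).ncard := by
  have hfin : (innerBoundary G X).Finite := X.finite_toSet.subset fun x hx => hx.1
  have h1 : layer G X 1 ⊆ innerBoundary G X := by
    rintro x hx
    have hlow : ∀ y ∉ X, 1 ≤ G.dist x y := fun y hy =>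
      Nat.one_le_iff_ne_zero.2 fun h0 => hx.2 ⟨y, hy, by simp [h0]⟩
    obtain ⟨y, hy, hxy⟩ := hx.1
    exact ⟨layer_subset 1 hx, ⟨y, hy, le_antisymm hxy (hlow y hy)⟩, hlow⟩
  have h2 : ((X.filter fun x => depth G X x = k : Finset Γ) : Set Γ) ⊆ layer G X k := by
    intro x hx
    rw [Finset.mem_coe, Finset.mem_filter] at hx
    obtain ⟨y, hy, hxy⟩ := exists_dist_eq_depth (G := G) hy₀ x
    refine ⟨⟨y, hy, (hxy.trans hx.2).le⟩, ?_⟩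
    rintro ⟨z, hz, hxz⟩
    have := depth_le (G := G) (x := x) hz
    have := hx.2
    omega
  rw [← Set.ncard_coe_finset]
  exact (Set.ncard_le_ncard h2 (X.finite_toSet.subset (layer_subset k))).trans
    ((hX 1 k le_rfl hk).trans (Set.ncard_le_ncard h1 hfin))

lemma sum_comp_depth_le [DecidableEq Γ] (hG : G.Connected) {y₀ : Γ} (hy₀ : y₀ ∉ X)
    (hX : ∀ m n : ℕ, 1 ≤ m → m ≤ n → (layer G X n).ncard ≤ (layer G X m).ncard)
    {f : ℕ → ℝ} (hf0 : ∀ k, 0 ≤ f k) (hf : Summable fun k => f (k + 1)) :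
    ∑ x ∈ X, f (depth G X x) ≤ (innerBoundary G X).ncard * ∑' k, f (k + 1) := by
  have hd : ∀ x ∈ X, depth G X x - 1 + 1 = depth G X x := fun x hx =>
    Nat.sub_add_cancel (depth_pos hG hy₀ hx)
  have h1 : ∑ x ∈ X, f (depth G X x) = ∑ x ∈ X, (fun k => f (k + 1)) (depth G X x - 1) :=
    Finset.sum_congr rfl fun x hx => by simp only [hd x hx]
  rw [h1, Finset.sum_comp (fun k => f (k + 1))]
  calc _ ≤ ∑ k ∈ X.image fun x => depth G X x - 1, (innerBoundary G X).ncard * f (k + 1) := by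
        refine Finset.sum_le_sum fun k _ => ?_
        rw [nsmul_eq_mul]
        refine mul_le_mul_of_nonneg_right (Nat.cast_le.2 ?_) (hf0 _)
        refine le_trans (Finset.card_le_card fun x hx => ?_)
          (card_filter_depth_le hy₀ hX (Nat.le_add_left 1 k))
        rw [Finset.mem_filter] at hx ⊢
        exact ⟨hx.1, by rw [← hd x hx.1, hx.2]⟩
    _ ≤ _ := by
        rw [← Finset.mul_sum]
        exact mul_le_mul_of_nonneg_left (hf.sum_le_tsum _ fun k _ => hf0 _) (Nat.cast_nonneg _)

end Layers

/-! ### Crossing terms and distances between fattened surfaces. -/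

section SurfaceBounds

variable {Γ : Type*} {G : SimpleGraph Γ} {X Λ : Finset Γ} {F ξ : ℝ → ℝ}

/-- The total strength of the terms that cross the boundary of `X` without being contained in
the fattened surface. -/
lemma sum_crossing_not_subset_surface_le [DecidableEq Γ] (hG : G.Connected)
    (hF_pos : ∀ r, 0 ≤ r → 0 < F r)
    (hF_norm : decayNorm G F < ⊤)
    (hξ_pos : ∀ r, 0 ≤ r → 0 < ξ r) (hξ_anti : AntitoneOn ξ (Set.Ici 0))
    (hξ_sum : Summable fun k : ℕ => ξ k)
    (hX : ∀ m n : ℕ, 1 ≤ m → m ≤ n → (layer G X n).ncard ≤ (layer G X m).ncard)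
    {φ : Finset Γ → ℝ} (hφ : ∀ Z, 0 ≤ φ Z) {N : ℝ} (hN : 0 ≤ N)
    (hφN : ∀ (S : Finset (Finset Γ)) (x y : Γ), ∑ Z ∈ S with x ∈ Z ∧ y ∈ Z, φ Z
      ≤ N * (F (G.dist x y) * ξ (G.dist x y))) (m : ℕ) :
    ∑ Z ∈ Λ.powerset with ((Z ∩ X).Nonempty ∧ (Z ∩ (Λ \ X)).Nonempty) ∧ ¬Z ⊆ surface G X Λ m, φ Z
      ≤ (innerBoundary G X).ncard * N * (decayNorm G F).toReal * (2 * zetaTail ξ m) := by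
  classical
  have hξ0 : ∀ k : ℕ, 0 ≤ ξ k := fun k => (hξ_pos _ (Nat.cast_nonneg _)).le
  have hξle : ∀ {j k : ℕ}, j ≤ k → ξ k ≤ ξ j := fun h =>
    hξ_anti (Set.mem_Ici.2 (Nat.cast_nonneg _)) (Set.mem_Ici.2 (Nat.cast_nonneg _))
      (Nat.cast_le.2 h)
  have hζ : 0 ≤ zetaTail ξ m := tsum_nonneg fun k => hξ0 _
  -- If `X` is the whole graph, nothing crosses its boundary.
  by_cases hy₀ : ∃ y₀, y₀ ∉ X
  swap
  · push Not at hy₀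
    rw [Finset.filter_eq_empty_iff.2, Finset.sum_empty]
    · positivity
    · rintro Z - ⟨⟨-, y, hy⟩, -⟩
      exact (Finset.mem_sdiff.1 (Finset.mem_inter.1 hy).2).2 (hy₀ y)
  obtain ⟨y₀, hy₀⟩ := hy₀
  -- A crossing set that leaves the surface has a point `z` outside it. If `z ∈ X`, then `z` has
  -- depth at least `m + 1`, and its distance to any point outside `X` is at least that depth:
  -- weight `w₁`. If `z ∉ X`, then any `x ∈ X` is at distance at least `m + depth x` from `z`:
  -- weight `w₂`. Summed over depths `k ≥ 1`, each weight gives `ζ(m)`.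
  let w₁ : ℕ → ℝ := fun k => if m + 1 ≤ k then ξ k else 0
  let w₂ : ℕ → ℝ := fun k => ξ ((m + k : ℕ) : ℝ)
  have hw₁0 : ∀ k, 0 ≤ w₁ k := fun k => by
    simp only [w₁]
    split_ifs
    exacts [hξ0 k, le_rfl]
  have hw₂0 : ∀ k, 0 ≤ w₂ k := fun k => hξ0 _
  have hs1 : Summable fun k : ℕ => ξ ((m + 1 + k : ℕ) : ℝ) := by
    have := (summable_nat_add_iff (m + 1)).2 hξ_sum
    simpa only [add_comm] using this
  have hζs : HasSum (fun k : ℕ => ξ ((m + 1 + k : ℕ) : ℝ)) (zetaTail ξ m) := hs1.hasSum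
  have hw₁ : HasSum (fun k => w₁ (k + 1)) (zetaTail ξ m) := by
    rw [← hasSum_nat_add_iff' m]
    have h0 : ∑ i ∈ Finset.range m, w₁ (i + 1) = 0 := Finset.sum_eq_zero fun i hi => by
      have := Finset.mem_range.1 hi
      exact if_neg (by omega)
    rw [h0, sub_zero]
    have h1 : ∀ k, w₁ (k + m + 1) = ξ ((m + 1 + k : ℕ) : ℝ) := fun k => by
      rw [show k + m + 1 = m + 1 + k by omega]
      exact if_pos (by omega)
    simpa only [h1] using hζs
  have hw₂ : HasSum (fun k => w₂ (k + 1)) (zetaTail ξ m) := by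
    convert hζs using 2 with k
    simp only [w₂]
    congr 2
    omega
  have hw := hw₁.add hw₂
  set w : ℕ → ℝ := fun k => w₁ k + w₂ k with hwdef
  have hw0 : ∀ k, 0 ≤ w k := fun k => add_nonneg (hw₁0 k) (hw₂0 k)
  have hF0 : ∀ x y, 0 ≤ F (G.dist x y) := fun x y => (hF_pos _ (Nat.cast_nonneg _)).le
  set P : Finset (Γ × Γ) := {p ∈ X ×ˢ (Λ \ X) | ξ (G.dist p.1 p.2) ≤ w (depth G X p.1)} with hP
  calc _ ≤ ∑ p ∈ P, N * (F (G.dist p.1 p.2) * ξ (G.dist p.1 p.2)) := by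
        refine sum_le_sum_pairs hφ _ (fun x y => hφN _ x y) P fun Z hZ => ?_
        simp only [Finset.mem_filter, Finset.mem_powerset] at hZ
        obtain ⟨hZΛ, ⟨⟨x, hx⟩, ⟨y, hy⟩⟩, hZs⟩ := hZ
        obtain ⟨z, hzZ, hzs⟩ := Finset.not_subset.1 hZs
        have hzΛ := hZΛ hzZ
        rw [Finset.mem_inter] at hx hy
        have hzf : z ∉ fatBoundary G X m := fun h =>
          hzs (by simp only [surface, Finset.mem_filter]; exact ⟨hzΛ, h⟩)
        by_cases hzX : z ∈ X
        · refine ⟨(z, y), ?_, hzZ, hy.1⟩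
          rw [hP, Finset.mem_filter, Finset.mem_product]
          refine ⟨⟨hzX, hy.2⟩, ?_⟩
          have hd : m + 1 ≤ depth G X z := by
            obtain ⟨u, hu, hzu⟩ := exists_dist_eq_depth (G := G) hy₀ z
            by_contra hlt
            exact hzf ⟨⟨z, hzX, by simp⟩, ⟨u, hu, by omega⟩⟩
          have h1 : w₁ (depth G X z) = ξ (depth G X z) := if_pos hd
          calc ξ (G.dist z y) ≤ ξ (depth G X z) :=
                hξle (depth_le (Finset.mem_sdiff.1 hy.2).2)
            _ = w₁ (depth G X z) := h1.symm
            _ ≤ w (depth G X z) := le_add_of_nonneg_right (hw₂0 _)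
        · refine ⟨(x, z), ?_, hx.1, hzZ⟩
          rw [hP, Finset.mem_filter, Finset.mem_product]
          refine ⟨⟨hx.2, Finset.mem_sdiff.2 ⟨hzΛ, hzX⟩⟩, ?_⟩
          have hd : m + depth G X x ≤ G.dist x z := by
            refine add_depth_le_dist hG hx.2 fun x' hx' => ?_
            by_contra hlt
            rw [G.dist_comm] at hlt
            exact hzf ⟨⟨x', hx', by omega⟩, ⟨z, hzX, by simp⟩⟩
          calc ξ (G.dist x z) ≤ w₂ (depth G X x) := hξle hd
            _ ≤ w (depth G X x) := le_add_of_nonneg_left (hw₁0 _)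
    _ ≤ ∑ p ∈ P, N * (F (G.dist p.1 p.2) * w (depth G X p.1)) := by
        refine Finset.sum_le_sum fun p hp => ?_
        have := (Finset.mem_filter.1 hp).2
        have := hF0 p.1 p.2
        gcongr
    _ ≤ ∑ p ∈ X ×ˢ (Λ \ X), N * (F (G.dist p.1 p.2) * w (depth G X p.1)) :=
        Finset.sum_le_sum_of_subset_of_nonneg (Finset.filter_subset _ _)
          fun p _ _ => mul_nonneg hN (mul_nonneg (hF0 _ _) (hw0 _))
    _ = N * ∑ x ∈ X, (∑ y ∈ Λ \ X, F (G.dist x y)) * w (depth G X x) := by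
        rw [Finset.sum_product, Finset.mul_sum]
        refine Finset.sum_congr rfl fun x _ => ?_
        rw [Finset.sum_mul, Finset.mul_sum]
    _ ≤ N * ∑ x ∈ X, (decayNorm G F).toReal * w (depth G X x) := by
        gcongr with x _
        · exact hw0 _
        · exact sum_le_toReal_decayNorm hF_pos hF_norm x _
    _ ≤ N * ((decayNorm G F).toReal *
          ((innerBoundary G X).ncard * (zetaTail ξ m + zetaTail ξ m))) := by
        rw [← Finset.mul_sum, ← hw.tsum_eq]
        gcongr
        exact sum_comp_depth_le hG hy₀ hX hw0 hw.summable
    _ = _ := by ring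

/-- Points of the fattened surface of width `m` and points of `Λ` outside the one of width `R`
are at distance at least `R - m`. -/
lemma le_dist_of_mem_surface (hG : G.Connected) {m R : ℕ} {x z : Γ} (hx : x ∈ surface G X Λ m)
    (hz : z ∈ Λ) (hzR : z ∉ surface G X Λ R) : R - m ≤ G.dist x z := by
  simp only [surface, Finset.mem_filter, not_and] at hx hzR
  obtain ⟨⟨y, hy, hxy⟩, ⟨y', hy', hxy'⟩⟩ := hx.2
  by_contra hlt
  have h1 : G.dist z y ≤ G.dist x z + G.dist x y := by
    rw [G.dist_comm (u := x) (v := z)]; exact hG.dist_triangle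
  have h2 : G.dist z y' ≤ G.dist x z + G.dist x y' := by
    rw [G.dist_comm (u := x) (v := z)]; exact hG.dist_triangle
  exact hzR hz ⟨⟨y, hy, by omega⟩, ⟨y', hy', by omega⟩⟩

/-- The total interaction between the two fattened surfaces decays like `ξ`. -/
lemma sum_surface_sdiff_le [DecidableEq Γ] (hG : G.Connected) (hF_pos : ∀ r, 0 ≤ r → 0 < F r)
    (hF_norm : decayNorm G F < ⊤)
    (hξ_anti : AntitoneOn ξ (Set.Ici 0)) (hξ_pos : ∀ r, 0 ≤ r → 0 < ξ r) (R : ℕ) :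
    ∑ x ∈ surface G X Λ (R / 2), ∑ z ∈ Λ \ surface G X Λ R, F (G.dist x z) * ξ (G.dist x z)
      ≤ (surface G X Λ (R / 2)).card * ((decayNorm G F).toReal * ξ ((R / 2 : ℕ) : ℝ)) := by
  rw [← nsmul_eq_mul]
  refine Finset.sum_le_card_nsmul _ _ _ fun x hx => ?_
  have hξ0 : 0 ≤ ξ ((R / 2 : ℕ) : ℝ) := (hξ_pos _ (Nat.cast_nonneg _)).le
  calc _ ≤ ∑ z ∈ Λ \ surface G X Λ R, F (G.dist x z) * ξ ((R / 2 : ℕ) : ℝ) := by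
        refine Finset.sum_le_sum fun z hz => ?_
        rw [Finset.mem_sdiff] at hz
        refine mul_le_mul_of_nonneg_left ?_ (hF_pos _ (Nat.cast_nonneg _)).le
        -- The distance is at least `R - ⌊R/2⌋ ≥ ⌊R/2⌋`. The factor `ξ` is spent on this separation,
        -- and `F` alone is left to be summed.
        refine hξ_anti (Set.mem_Ici.2 (Nat.cast_nonneg _)) (Set.mem_Ici.2 (Nat.cast_nonneg _)) ?_
        have := le_dist_of_mem_surface hG hx hz.1 hz.2
        exact Nat.cast_le.2 (by omega)
    _ ≤ _ := by
        rw [← Finset.sum_mul]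
        exact mul_le_mul_of_nonneg_right (sum_le_toReal_decayNorm hF_pos hF_norm x _) hξ0

end SurfaceBounds

/-! ### Images, products and quotients of flows. -/

namespace IsFlow

section

variable {A B : Type*} [CStarAlgebra A] [CStarAlgebra B] {T t : ℝ} {H V : ℝ → A}

/-- The image of a flow under a homomorphism of star algebras is a flow. -/
lemma map (hV : IsFlow T t H V) (φ : A →⋆ₐ[ℂ] B) :
    IsFlow T t (fun s => φ (H s)) (fun s => φ (V s)) := by
  refine ⟨by simp [hV.1], fun s hs => ?_⟩
  have hφ : Continuous φ :=
    AddMonoidHomClass.continuous_of_bound φ 1 fun a => by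
      simpa using NonUnitalStarAlgHom.norm_apply_le φ a
  let L : A →L[ℝ] B := ⟨(φ : A →ₗ[ℂ] B).restrictScalars ℝ, hφ⟩
  have h := L.hasFDerivAt.comp_hasDerivWithinAt s (hV.2 s hs)
  refine h.congr_deriv ?_
  change φ (Complex.I • (V s * H s)) = _
  rw [map_smul, map_mul]

/-- The product of commuting flows is the flow of the sum of the generators. -/
lemma mul {H₂ V₂ : ℝ → A} (hV : IsFlow T t H V) (hV₂ : IsFlow T t H₂ V₂)
    (hc : ∀ s ∈ Set.Icc (-T) T, Commute (H s) (V₂ s)) :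
    IsFlow T t (fun s => H s + H₂ s) (fun s => V s * V₂ s) := by
  refine ⟨by simp [hV.1, hV₂.1], fun s hs => ?_⟩
  refine ((hV.2 s hs).fun_mul (hV₂.2 s hs)).congr_deriv ?_
  rw [smul_mul_assoc, mul_smul_comm, ← smul_add, mul_assoc, (hc s hs).eq, mul_add]
  simp only [mul_assoc]

/-- The flow relating two given flows. -/
lemma mul_star [IsDedekindFiniteMonoid A] {H₂ V₂ : ℝ → A} (hV : IsFlow T t H V)
    (hV₂ : IsFlow T t H₂ V₂)
    (hH₂ : ∀ s ∈ Set.Icc (-T) T, IsSelfAdjoint (H₂ s)) (ht : t ∈ Set.Icc (-T) T) :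
    IsFlow T t (fun s => V₂ s * (H s - H₂ s) * star (V₂ s)) (fun s => V s * star (V₂ s)) := by
  refine ⟨by simp [hV.1, hV₂.1], fun s hs => ?_⟩
  have h := hV.hasDerivWithinAt_conj hV₂ hH₂ hs (hasDerivWithinAt_const s _ (1 : A))
  simp only [mul_one, one_mul, mul_zero, zero_mul, add_zero] at h
  refine h.congr_deriv ?_
  have h1 : V s * star (V₂ s) * (V₂ s * (H s - H₂ s) * star (V₂ s)) =
      V s * (star (V₂ s) * V₂ s) * (H s - H₂ s) * star (V₂ s) := by simp only [mul_assoc]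
  rw [h1, Unitary.star_mul_self_of_mem (hV₂.mem_unitary hH₂ ht hs), mul_one]

end

end IsFlow

/-! ### Spin evolutions as flows. -/

section Evolution

variable {Γ : Type*} [DecidableEq Γ] {q : Γ → ℕ} {T t : ℝ}
  {Ψ : (Z : Finset Γ) → ℝ → LocalAlgebra q Z}

lemma isSelfAdjoint_hamiltonian (hΨ_sa : ∀ Z, ∀ t ∈ Set.Icc (-T) T, IsSelfAdjoint (Ψ Z t))
    (Λ : Finset Γ) : ∀ s ∈ Set.Icc (-T) T, IsSelfAdjoint (hamiltonian Ψ Λ s) :=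
  fun _ hs => isSelfAdjoint_interactionSum hΨ_sa _ _ hs

lemma isFlow_evolution (hT : 0 < T)
    (hΨ_sa : ∀ Z, ∀ t ∈ Set.Icc (-T) T, IsSelfAdjoint (Ψ Z t))
    (hΨ : ∀ Z, ContinuousOn (Ψ Z) (Set.Icc (-T) T)) (Λ : Finset Γ)
    (ht : t ∈ Set.Icc (-T) T) : IsFlow T t (hamiltonian Ψ Λ) (evolution T Ψ Λ t) :=
  (isPropagator_evolution hT hΨ Λ).isFlow (isSelfAdjoint_hamiltonian hΨ_sa Λ) ht

lemma continuousOn_sigma (hT : 0 < T)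
    (hΨ_sa : ∀ Z, ∀ t ∈ Set.Icc (-T) T, IsSelfAdjoint (Ψ Z t))
    (hΨ : ∀ Z, ContinuousOn (Ψ Z) (Set.Icc (-T) T)) (Λ : Finset Γ)
    (ht : t ∈ Set.Icc (-T) T) {K : ℝ → LocalAlgebra q Λ}
    (hK : ContinuousOn K (Set.Icc (-T) T)) :
    ContinuousOn (fun s => sigma T Ψ Λ t s (K s)) (Set.Icc (-T) T) :=
  have hV := (isFlow_evolution hT hΨ_sa hΨ Λ ht).continuousOn
  (hV.mul hK).mul hV.star

/-- Taking adjoints moves the generator to the right of `Û` and changes the sign of `i`; the sign is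
absorbed into the generator. -/
lemma isLeftSurfaceEvolution_iff (G : SimpleGraph Γ)
    (hΨ_sa : ∀ Z, ∀ t ∈ Set.Icc (-T) T, IsSelfAdjoint (Ψ Z t))
    (X Λ : Finset Γ) (R : ℕ)
    (Uhat : ℝ → ℝ → LocalAlgebra q (surface G X Λ R)) :
    IsLeftSurfaceEvolution G T Ψ X Λ R Uhat ↔ ∀ t ∈ Set.Icc (-T) T, IsFlow T t
      (fun s => -sigma T Ψ (surface G X Λ R) t s (surfaceEnergy G Ψ X Λ R s)) (Uhat t) := by
  have hsa : ∀ t, ∀ s ∈ Set.Icc (-T) T,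
      IsSelfAdjoint (sigma T Ψ (surface G X Λ R) t s (surfaceEnergy G Ψ X Λ R s)) :=
    fun t s hs => (isSelfAdjoint_interactionSum hΨ_sa _ _ hs).conjugate _
  refine forall₂_congr fun t _ => and_congr
    (star_eq_iff_star_eq.trans (by rw [star_one, eq_comm])) (forall₂_congr fun s hs => ?_)
  have h1 : ∀ a b : LocalAlgebra q (surface G X Λ R), IsSelfAdjoint a →
      star (Complex.I • (a * star b)) = Complex.I • (b * -a) := fun a b ha => by
    rw [star_smul, star_mul, star_star, ha.star_eq, Complex.star_def, Complex.conj_I]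
    simp
  constructor
  · intro h
    have h' := h.star
    simp only [star_star] at h'
    rwa [h1 _ _ (hsa t s hs)] at h'
  · intro h
    have h' := h.star
    rwa [← h1 _ _ (hsa t s hs), star_star] at h'

end Evolution

/-! ### Estimate of the difference of the generators of `W` and `Û`. -/

section MainEstimate

variable {Γ : Type*} [DecidableEq Γ] {G : SimpleGraph Γ} {q : Γ → ℕ} {F ξ : ℝ → ℝ} {T t : ℝ}
  {Ψ : (Z : Finset Γ) → ℝ → LocalAlgebra q Z} {X Λ : Finset Γ}

/-- The norm of the surface energy is at most of the order of the surface. -/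
lemma norm_embed_surfaceEnergy_le (hF : ∀ r, 0 ≤ r → 0 < F r) (hF_norm : decayNorm G F < ⊤)
    (hΨ : ∀ Z, ContinuousOn (Ψ Z) (Set.Icc (-T) T)) (hΨ_norm : interactionNorm G F T Ψ < ⊤)
    (R : ℕ) {s : ℝ} (hs : s ∈ Set.Icc (-T) T) :
    ‖embed (surface_subset G X Λ R) (surfaceEnergy G Ψ X Λ R s)‖ ≤
      (surface G X Λ (R / 2)).card *
        ((interactionNorm G F T Ψ).toReal * (decayNorm G F).toReal) := by
  rw [surfaceEnergy, embed_interactionSum]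
  calc _ ≤ ∑ Z ∈ crossingSets G X Λ (R / 2), strength T Ψ Z :=
        (norm_sum_le _ _).trans (Finset.sum_le_sum fun Z _ =>
          (norm_termIn_le _ _ _).trans (norm_le_strength hΨ Z hs))
    _ ≤ ∑ p ∈ surface G X Λ (R / 2) ×ˢ surface G X Λ (R / 2),
          (interactionNorm G F T Ψ).toReal * F (G.dist p.1 p.2) := by
        refine sum_le_sum_pairs strength_nonneg _
          (fun x y => sum_strength_le hF hΨ hΨ_norm _ x y) _ fun Z hZ => ?_
        simp only [crossingSets, Finset.mem_filter, Finset.mem_powerset] at hZ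
        obtain ⟨hZs, ⟨x, hx⟩, ⟨y, hy⟩⟩ := hZ
        have hx' := (Finset.mem_inter.1 hx).1
        have hy' := (Finset.mem_inter.1 hy).1
        exact ⟨(x, y), Finset.mem_product.2 ⟨hZs hx', hZs hy'⟩, hx', hy'⟩
    _ ≤ _ := by
        rw [Finset.sum_product, ← nsmul_eq_mul]
        refine Finset.sum_le_card_nsmul _ _ _ fun x _ => ?_
        rw [← Finset.mul_sum]
        exact mul_le_mul_of_nonneg_left (sum_le_toReal_decayNorm hF hF_norm x _)
          ENNReal.toReal_nonneg

/-- The crossing energy is the surface energy up to the terms that leave the fattened surface. -/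
lemma norm_negCrossingEnergy_add_surfaceEnergy_le (hG : G.Connected)
    (hF_pos : ∀ r, 0 ≤ r → 0 < F r) (hF_norm : decayNorm G F < ⊤)
    (hξ_pos : ∀ r, 0 ≤ r → 0 < ξ r) (hξ_anti : AntitoneOn ξ (Set.Ici 0))
    (hξ_sum : Summable fun k : ℕ => ξ k)
    (hX : ∀ m n : ℕ, 1 ≤ m → m ≤ n → (layer G X n).ncard ≤ (layer G X m).ncard)
    (hΨ : ∀ Z, ContinuousOn (Ψ Z) (Set.Icc (-T) T))
    (hΨ_norm : interactionNorm G (fun r => F r * ξ r) T Ψ < ⊤)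
    (R : ℕ) {s : ℝ} (hs : s ∈ Set.Icc (-T) T) :
    ‖negCrossingEnergy Ψ X Λ s +
        embed (surface_subset G X Λ R) (surfaceEnergy G Ψ X Λ R s)‖ ≤
      (innerBoundary G X).ncard * (interactionNorm G (fun r => F r * ξ r) T Ψ).toReal
        * (decayNorm G F).toReal * (2 * zetaTail ξ (R / 2)) := by
  have hFξ : ∀ r, 0 ≤ r → 0 < F r * ξ r := fun r hr => mul_pos (hF_pos r hr) (hξ_pos r hr)
  have hsplit : negCrossingEnergy Ψ X Λ s +
      embed (surface_subset G X Λ R) (surfaceEnergy G Ψ X Λ R s) =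
      -∑ Z ∈ Λ.powerset with ((Z ∩ X).Nonempty ∧ (Z ∩ (Λ \ X)).Nonempty) ∧
        ¬Z ⊆ surface G X Λ (R / 2), termIn Ψ Λ Z s := by
    rw [negCrossingEnergy, interactionSum_eq, surfaceEnergy, embed_interactionSum,
      ← Finset.filter_filter (fun Z => (Z ∩ X).Nonempty ∧ (Z ∩ (Λ \ X)).Nonempty)
        (fun Z => ¬Z ⊆ surface G X Λ (R / 2)), ← Finset.sum_filter_add_sum_filter_not _
        (fun Z => Z ⊆ surface G X Λ (R / 2)) (fun Z => termIn Ψ Λ Z s)]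
    have h : crossingSets G X Λ (R / 2) = {Z ∈ {Z ∈ Λ.powerset | (Z ∩ X).Nonempty ∧
        (Z ∩ (Λ \ X)).Nonempty} | Z ⊆ surface G X Λ (R / 2)} := by
      ext Z
      simp only [crossingSets, Finset.mem_filter, Finset.mem_powerset]
      exact ⟨fun h => ⟨⟨h.1.trans (surface_subset G X Λ _), h.2⟩, h.1⟩, fun h => ⟨h.2, h.1.2⟩⟩
    rw [h]
    abel
  rw [hsplit, norm_neg]
  refine (norm_sum_le _ _).trans ((Finset.sum_le_sum fun Z _ =>
    (norm_termIn_le _ _ _).trans (norm_le_strength hΨ Z hs)).trans ?_)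
  exact sum_crossing_not_subset_surface_le hG hF_pos hF_norm hξ_pos hξ_anti hξ_sum hX
    strength_nonneg ENNReal.toReal_nonneg
    (fun S x y => sum_strength_le hFξ hΨ hΨ_norm S x y) (R / 2)

/-- Locality: the evolution of the surface energy in `Λ` is close to the one in the fattened
surface. -/
lemma norm_sigma_sub_embed_sigma_le [Nonempty Γ] (hF : ∀ r, 0 ≤ r → 0 < F r)
    (hF_conv : convConst G F < ⊤) (hT : 0 < T)
    (hΨ_sa : ∀ Z, ∀ t ∈ Set.Icc (-T) T, IsSelfAdjoint (Ψ Z t))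
    (hΨ : ∀ Z, ContinuousOn (Ψ Z) (Set.Icc (-T) T)) (hΨ_norm : interactionNorm G F T Ψ < ⊤)
    (R : ℕ) (ht : t ∈ Set.Icc (-T) T) {s : ℝ} (hs : s ∈ Set.Icc (-T) T) :
    ‖sigma T Ψ Λ t s (embed (surface_subset G X Λ R) (surfaceEnergy G Ψ X Λ R s)) -
        embed (surface_subset G X Λ R)
          (sigma T Ψ (surface G X Λ R) t s (surfaceEnergy G Ψ X Λ R s))‖ ≤
      ‖embed (surface_subset G X Λ R) (surfaceEnergy G Ψ X Λ R s)‖ *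
        ((∑ x ∈ surface G X Λ (R / 2), ∑ z ∈ Λ \ surface G X Λ R, F (G.dist x z)) /
          (convConst G F).toReal *
        (Real.exp (2 * (interactionNorm G F T Ψ).toReal * (convConst G F).toReal * |s - t|)
          - 1)) := by
  have hF0 : ∀ x y, 0 ≤ F (G.dist x y) := fun x y => (hF _ (Nat.cast_nonneg _)).le
  set ι := surface_subset G X Λ R
  set S : Finset (Finset Γ) := {Z ∈ Λ.powerset | Z.Nonempty}
  have hSΛ : ∀ Z ∈ S, Z ⊆ Λ := fun Z hZ => Finset.mem_powerset.1 (Finset.mem_filter.1 hZ).1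
  have hV : IsFlow T t (fun s => ∑ Z ∈ S, termIn Ψ Λ Z s) (evolution T Ψ Λ t) := by
    convert isFlow_evolution hT hΨ_sa hΨ Λ ht using 2 with s
    rw [hamiltonian, interactionSum_eq]
  have hV₀ : IsFlow T t (fun s => ∑ Z ∈ S with Z ⊆ surface G X Λ R, termIn Ψ Λ Z s)
      (fun s => embed ι (evolution T Ψ (surface G X Λ R) t s)) := by
    have h := (isFlow_evolution hT hΨ_sa hΨ (surface G X Λ R) ht).map (embedHom ι)
    simp only [embedHom_apply] at h
    convert h using 2 with s
    rw [hamiltonian, embed_interactionSum]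
    refine Finset.sum_congr ?_ fun _ _ => rfl
    ext Z
    simp only [S, Finset.mem_filter, Finset.mem_powerset]
    exact ⟨fun h => ⟨h.2, h.1.2⟩, fun h => ⟨⟨h.1.trans ι, h.2⟩, h.1⟩⟩
  have hσ : embed ι (sigma T Ψ (surface G X Λ R) t s (surfaceEnergy G Ψ X Λ R s)) =
      embed ι (evolution T Ψ (surface G X Λ R) t s) * embed ι (surfaceEnergy G Ψ X Λ R s) *
        star (embed ι (evolution T Ψ (surface G X Λ R) t s)) := by
    simp only [← embedHom_apply, sigma, map_mul, map_star]
  rw [hσ]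
  obtain ⟨x₀⟩ := ‹Nonempty Γ›
  refine norm_conj_sub_conj_le hT (S := S) (h := fun Z s => termIn Ψ Λ Z s)
    (φ := strength T Ψ) (fun Z _ => continuousOn_termIn hΨ Λ Z)
    (fun Z _ s hs => isSelfAdjoint_termIn hΨ_sa Λ Z hs)
    (fun Z _ s hs => (norm_termIn_le Λ Z s).trans (norm_le_strength hΨ Z hs))
    (fun Z _ Z' _ hd r _ r' _ => commute_termIn_of_disjoint Λ hd r r')
    (fun Z => Z ⊆ surface G X Λ R) hV hV₀
    -- The weight `a(Y)` measures the coupling of `Y` to the exterior of the larger surface. It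
    -- bounds the terms that join `Y` to this exterior, and it reproduces itself under the inner
    -- terms by the convolution estimate.
    (a := fun Y => ∑ x ∈ Y, ∑ z ∈ Λ \ surface G X Λ R, F (G.dist x z))
    (fun Y => Finset.sum_nonneg fun x _ => Finset.sum_nonneg fun z _ => hF0 x z)
    ENNReal.toReal_nonneg (toReal_convConst_pos hF hF_conv x₀)
    (fun Y => ?_) (fun Y => ?_) ht (surface G X Λ (R / 2)) _ (fun Z hZ hd r hr => ?_) hs
  · exact sum_mul_sum_le strength_nonneg (f := fun x y => F (G.dist x y)) ENNReal.toReal_nonneg hF0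
      _ (fun x y => sum_strength_le hF hΨ hΨ_norm _ x y) Λ
      (fun Z hZ => hSΛ Z (Finset.mem_filter.1 hZ).1)
      (fun x z => sum_mul_le_toReal_convConst hF hF_conv x z Λ) Y _
      fun Z hZ => (Finset.mem_filter.1 hZ).2.2
  · rw [← Finset.sum_product' (f := fun x z => F (G.dist x z)), Finset.mul_sum]
    refine sum_le_sum_pairs strength_nonneg
      (f := fun x y => (interactionNorm G F T Ψ).toReal * F (G.dist x y)) _
      (fun x y => sum_strength_le hF hΨ hΨ_norm _ x y) _ fun Z hZ => ?_
    rw [Finset.mem_filter] at hZ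
    obtain ⟨hZS, hZ0, hZY⟩ := hZ
    obtain ⟨z, hzZ, hz⟩ := Finset.not_subset.1 hZ0
    obtain ⟨x, hxZ, hxY⟩ := Finset.not_disjoint_iff.1 hZY
    exact ⟨(x, z), Finset.mem_product.2 ⟨hxY, Finset.mem_sdiff.2 ⟨hSΛ Z hZS hzZ, hz⟩⟩, hxZ, hzZ⟩
  · rw [surfaceEnergy, embed_interactionSum]
    refine Commute.sum_right _ _ _ fun Z' hZ' => commute_termIn_of_disjoint Λ ?_ r s
    exact hd.mono_right (Finset.mem_powerset.1 (Finset.mem_filter.1 hZ').1)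

/-- `σ_Λ(K) + σ_∂(S)` is small: the missing crossing terms and the change of the dynamics. -/
lemma norm_sigma_add_embed_sigma_le (hG : G.Connected)
    (hF_pos : ∀ r, 0 ≤ r → 0 < F r)
    (hF_norm : decayNorm G F < ⊤) (hF_conv : convConst G F < ⊤)
    (hξ_pos : ∀ r, 0 ≤ r → 0 < ξ r) (hξ_anti : AntitoneOn ξ (Set.Ici 0))
    (hξ_super : ∀ a b, 0 ≤ a → 0 ≤ b → ξ a * ξ b ≤ ξ (a + b))
    (hξ_sum : Summable fun k : ℕ => ξ k) (hT : 0 < T)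
    (hΨ_sa : ∀ Z, ∀ t ∈ Set.Icc (-T) T, IsSelfAdjoint (Ψ Z t))
    (hΨ : ∀ Z, ContinuousOn (Ψ Z) (Set.Icc (-T) T))
    (hΨ_norm : interactionNorm G (fun r => F r * ξ r) T Ψ < ⊤)
    {g d : ℝ} (hg : 0 < g)
    (hX : ∀ m n : ℕ, 1 ≤ m → m ≤ n → (layer G X n).ncard ≤ (layer G X m).ncard) {R : ℕ}
    (hcard : ((surface G X Λ (R / 2)).card : ℝ) ≤
      g * ((R / 2 : ℕ) : ℝ) ^ d * (innerBoundary G X).ncard)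
    (ht : t ∈ Set.Icc (-T) T) {s : ℝ} (hs : s ∈ Set.Icc (-T) T) :
    ‖sigma T Ψ Λ t s (negCrossingEnergy Ψ X Λ s) + embed (surface_subset G X Λ R)
        (sigma T Ψ (surface G X Λ R) t s (surfaceEnergy G Ψ X Λ R s))‖ ≤
      (innerBoundary G X).ncard * (interactionNorm G (fun r => F r * ξ r) T Ψ).toReal *
        (decayNorm G F).toReal *
        (2 * zetaTail ξ (R / 2) + (innerBoundary G X).ncard *
          (g ^ 2 * (decayNorm G (fun r => F r * ξ r)).toReal /
            (convConst G (fun r => F r * ξ r)).toReal) *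
          ((R / 2 : ℕ) : ℝ) ^ (2 * d) * ξ ((R / 2 : ℕ) : ℝ) *
          (Real.exp (2 * (interactionNorm G (fun r => F r * ξ r) T Ψ).toReal *
            (convConst G (fun r => F r * ξ r)).toReal * |s - t|) - 1)) := by
  have hFξ : ∀ r, 0 ≤ r → 0 < F r * ξ r := fun r hr => mul_pos (hF_pos r hr) (hξ_pos r hr)
  have hFξ_norm := decayNorm_mul_lt_top (G := G) hF_pos hF_norm hξ_pos hξ_anti hξ_super
  have hFξ_conv := convConst_mul_lt_top hG hF_pos hF_conv hξ_pos hξ_anti hξ_super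
  have := hG.nonempty
  obtain ⟨x₀⟩ := hG.nonempty
  set Fξ : ℝ → ℝ := fun r => F r * ξ r
  have hC : 0 < (convConst G Fξ).toReal := toReal_convConst_pos hFξ hFξ_conv x₀
  have h1 := norm_negCrossingEnergy_add_surfaceEnergy_le (Λ := Λ) hG hF_pos hF_norm hξ_pos
    hξ_anti hξ_sum hX hΨ hΨ_norm R hs
  have h2 := norm_embed_surfaceEnergy_le (X := X) (Λ := Λ) hFξ hFξ_norm hΨ hΨ_norm R hs
  have h3 := sum_surface_sdiff_le (X := X) (Λ := Λ) hG hF_pos hF_norm hξ_anti hξ_pos R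
  have h4 := norm_sigma_sub_embed_sigma_le (X := X) (Λ := Λ) hFξ hFξ_conv hT hΨ_sa hΨ hΨ_norm
    R ht hs
  have hu := (isFlow_evolution hT hΨ_sa hΨ Λ ht).mem_unitary
    (isSelfAdjoint_hamiltonian hΨ_sa Λ) ht hs
  set N := (interactionNorm G Fξ T Ψ).toReal
  set C := (convConst G Fξ).toReal
  set nF := (decayNorm G F).toReal
  set nFξ := (decayNorm G Fξ).toReal
  set c : ℝ := ((surface G X Λ (R / 2)).card : ℝ)
  set area : ℝ := ((innerBoundary G X).ncard : ℝ)
  set m : ℝ := ((R / 2 : ℕ) : ℝ)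
  set S := embed (surface_subset G X Λ R) (surfaceEnergy G Ψ X Λ R s)
  set σS := embed (surface_subset G X Λ R)
    (sigma T Ψ (surface G X Λ R) t s (surfaceEnergy G Ψ X Λ R s))
  set e := Real.exp (2 * N * C * |s - t|)
  set δ := ∑ x ∈ surface G X Λ (R / 2), ∑ z ∈ Λ \ surface G X Λ R,
    F (G.dist x z) * ξ (G.dist x z)
  have hδ : 0 ≤ δ := Finset.sum_nonneg fun x _ => Finset.sum_nonneg fun z _ =>
    (hFξ _ (Nat.cast_nonneg _)).le
  have hN : 0 ≤ N := ENNReal.toReal_nonneg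
  have hnF : 0 ≤ nF := ENNReal.toReal_nonneg
  have hnFξ : 0 ≤ nFξ := ENNReal.toReal_nonneg
  have hm : 0 ≤ m := Nat.cast_nonneg _
  have hξm : 0 ≤ ξ m := (hξ_pos m hm).le
  have hc : 0 ≤ c := Nat.cast_nonneg _
  have he : 0 ≤ e - 1 := sub_nonneg.2 (Real.one_le_exp (by positivity))
  -- Both energies are first evolved in `Λ`, where `K + S` is small; what remains is the change of
  -- dynamics for `S` alone.
  have hsplit : sigma T Ψ Λ t s (negCrossingEnergy Ψ X Λ s) + σS =
      sigma T Ψ Λ t s (negCrossingEnergy Ψ X Λ s + S) - (sigma T Ψ Λ t s S - σS) := by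
    simp only [sigma, mul_add, add_mul]
    abel
  have hmd : (m ^ d) ^ 2 = m ^ (2 * d) := by
    rw [mul_comm, Real.rpow_mul hm, Real.rpow_ofNat]
  calc ‖sigma T Ψ Λ t s (negCrossingEnergy Ψ X Λ s) + σS‖
      ≤ ‖negCrossingEnergy Ψ X Λ s + S‖ + ‖sigma T Ψ Λ t s S - σS‖ := by
        rw [hsplit]
        refine (norm_sub_le _ _).trans_eq ?_
        rw [sigma, norm_conj_of_mem_unitary hu]
    -- The norm of `S` contributes one factor `c` with `‖F_ξ‖`, and the coupling to the exterior
    -- another with `‖F‖ ξ(m)`.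
    _ ≤ area * N * nF * (2 * zetaTail ξ (R / 2)) +
          c * (N * nFξ) * (c * (nF * ξ m) / C * (e - 1)) := by
        refine add_le_add h1 (h4.trans ?_)
        gcongr
    _ ≤ area * N * nF * (2 * zetaTail ξ (R / 2)) +
          (g * m ^ d * area) * (N * nFξ) * ((g * m ^ d * area) * (nF * ξ m) / C * (e - 1)) := by
        gcongr
    _ = _ := by
        rw [← hmd]
        ring

end MainEstimate

/-! ### The surface evolution and the flow comparing the decoupled and full dynamics. -/

section SurfaceEvolution

variable {Γ : Type*} [DecidableEq Γ] {G : SimpleGraph Γ} {q : Γ → ℕ} {T t : ℝ}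
  {Ψ : (Z : Finset Γ) → ℝ → LocalAlgebra q Z} {X Λ : Finset Γ}

lemma isSelfAdjoint_sigma {K : LocalAlgebra q Λ} (hK : IsSelfAdjoint K) (s : ℝ) :
    IsSelfAdjoint (sigma T Ψ Λ t s K) := hK.conjugate _

lemma continuousOn_surfaceEnergy (hΨ : ∀ Z, ContinuousOn (Ψ Z) (Set.Icc (-T) T)) (R : ℕ) :
    ContinuousOn (surfaceEnergy G Ψ X Λ R) (Set.Icc (-T) T) :=
  continuousOn_interactionSum hΨ (crossingSets G X Λ (R / 2)) fun _ h =>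
    (Finset.mem_powerset.1 (Finset.mem_filter.1 h).1).trans
      (surface_mono G X Λ (Nat.div_le_self R 2))

lemma continuousOn_negCrossingEnergy (hΨ : ∀ Z, ContinuousOn (Ψ Z) (Set.Icc (-T) T)) :
    ContinuousOn (negCrossingEnergy Ψ X Λ) (Set.Icc (-T) T) :=
  (continuousOn_interactionSum hΨ _ _).neg

lemma isSelfAdjoint_negCrossingEnergy
    (hΨ_sa : ∀ Z, ∀ t ∈ Set.Icc (-T) T, IsSelfAdjoint (Ψ Z t)) {s : ℝ}
    (hs : s ∈ Set.Icc (-T) T) : IsSelfAdjoint (negCrossingEnergy Ψ X Λ s) :=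
  (isSelfAdjoint_interactionSum hΨ_sa _ _ hs).neg

lemma exists_isLeftSurfaceEvolution (hT : 0 < T)
    (hΨ_sa : ∀ Z, ∀ t ∈ Set.Icc (-T) T, IsSelfAdjoint (Ψ Z t))
    (hΨ : ∀ Z, ContinuousOn (Ψ Z) (Set.Icc (-T) T)) (R : ℕ) :
    ∃ Uhat, IsLeftSurfaceEvolution G T Ψ X Λ R Uhat := by
  have h : ∀ t, ∃ V, t ∈ Set.Icc (-T) T → IsFlow T t
      (fun s => -sigma T Ψ (surface G X Λ R) t s (surfaceEnergy G Ψ X Λ R s)) V := by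
    intro t
    by_cases ht : t ∈ Set.Icc (-T) T
    · obtain ⟨V, hV⟩ := exists_isFlow hT
        (continuousOn_sigma hT hΨ_sa hΨ (surface G X Λ R) ht
          (continuousOn_surfaceEnergy hΨ R)).neg
        (fun s hs => (isSelfAdjoint_sigma (isSelfAdjoint_interactionSum hΨ_sa _ _ hs) s).neg) ht
      exact ⟨V, fun _ => hV⟩
    -- Nothing is required for `t` outside `[-T,T]`.
    · exact ⟨0, fun h => absurd h ht⟩
  choose Uhat hU using h
  exact ⟨Uhat, (isLeftSurfaceEvolution_iff G hΨ_sa X Λ R Uhat).2 hU⟩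

/-- The decoupled dynamics is the flow of the decoupled Hamiltonian. -/
lemma isFlow_tensorOp_evolution (hT : 0 < T)
    (hΨ_sa : ∀ Z, ∀ t ∈ Set.Icc (-T) T, IsSelfAdjoint (Ψ Z t))
    (hΨ : ∀ Z, ContinuousOn (Ψ Z) (Set.Icc (-T) T)) (h : X ⊆ Λ) (ht : t ∈ Set.Icc (-T) T) :
    IsFlow T t
      (fun s => embed h (hamiltonian Ψ X s) + embed Finset.sdiff_subset (hamiltonian Ψ (Λ \ X) s))
      (fun s => tensorOp h (evolution T Ψ X t s) (evolution T Ψ (Λ \ X) t s)) := by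
  have h1 := (isFlow_evolution hT hΨ_sa hΨ X ht).map (embedHom h)
  have h2 := (isFlow_evolution hT hΨ_sa hΨ (Λ \ X) ht).map (embedHom (Finset.sdiff_subset (s := Λ)))
  simp only [embedHom_apply] at h1 h2
  simp only [tensorOp_eq_mul]
  exact h1.mul h2 fun s _ => commute_embed_of_disjoint h _ Finset.disjoint_sdiff _ _

/-- The flow which relates the decoupled dynamics to the full one is generated by the evolved
crossing energy. -/
lemma isFlow_tensorOp_mul_star (hT : 0 < T)
    (hΨ_sa : ∀ Z, ∀ t ∈ Set.Icc (-T) T, IsSelfAdjoint (Ψ Z t))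
    (hΨ : ∀ Z, ContinuousOn (Ψ Z) (Set.Icc (-T) T)) (h : X ⊆ Λ) (ht : t ∈ Set.Icc (-T) T) :
    IsFlow T t (fun s => sigma T Ψ Λ t s (negCrossingEnergy Ψ X Λ s))
      (fun s => tensorOp h (evolution T Ψ X t s) (evolution T Ψ (Λ \ X) t s) *
        star (evolution T Ψ Λ t s)) := by
  have h1 := (isFlow_tensorOp_evolution hT hΨ_sa hΨ h ht).mul_star
    (isFlow_evolution hT hΨ_sa hΨ Λ ht) (isSelfAdjoint_hamiltonian hΨ_sa Λ) ht
  simp only [hamiltonian_split] at h1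
  exact h1

end SurfaceEvolution

end QSpin

end

/-! ### The factorisation estimate. -/

theorem mainTheorem2 {Γ : Type*} [DecidableEq Γ] [Countable Γ]
    -- the lattice, with its graph distance
    (G : SimpleGraph Γ) (hG : G.Connected)
    -- the local dimensions
    (q : Γ → ℕ)
    -- the decay functions
    (F ξ : ℝ → ℝ)
    (hF_pos : ∀ r, 0 ≤ r → 0 < F r)
    (hF_norm : decayNorm G F < ⊤) (hF_conv : convConst G F < ⊤)
    (hξ_pos : ∀ r, 0 ≤ r → 0 < ξ r) (hξ_anti : AntitoneOn ξ (Set.Ici 0))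
    (hξ_super : ∀ a b, 0 ≤ a → 0 ≤ b → ξ a * ξ b ≤ ξ (a + b))
    (hξ_decay : ∀ n : ℕ, Filter.Tendsto (fun r : ℝ => ξ r * r ^ n) Filter.atTop (nhds 0))
    -- the interaction
    (T : ℝ) (hT : 0 < T)
    (Ψ : (Z : Finset Γ) → ℝ → LocalAlgebra q Z)
    (hΨ_sa : ∀ Z, ∀ t ∈ Set.Icc (-T) T, IsSelfAdjoint (Ψ Z t))
    (hΨ_cont : ∀ Z, ContinuousOn (Ψ Z) (Set.Icc (-T) T))
    (hΨ_norm : interactionNorm G (fun r => F r * ξ r) T Ψ < ⊤)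
    -- the growth of fattened surfaces
    (g d : ℝ) (hg : 0 < g) (hd : 0 ≤ d)
    (hfat : ∀ (Y : Finset Γ) (n : ℕ),
      ((fatBoundary G Y n).ncard : ℝ) ≤ g * (n : ℝ) ^ d * ((innerBoundary G Y).ncard : ℝ))
    -- the set to be factored out
    (X : Finset Γ)
    (hX : ∀ m n : ℕ, 1 ≤ m → m ≤ n → (layer G X n).ncard ≤ (layer G X m).ncard)
    (R : ℕ) (Λ : Finset Γ) (hΛ : thickening G (X : Set Γ) R ⊆ (Λ : Set Γ)) :
    (∃ Uhat, IsLeftSurfaceEvolution G T Ψ X Λ R Uhat) ∧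
    ∀ Uhat, IsLeftSurfaceEvolution G T Ψ X Λ R Uhat →
      ∀ t ∈ Set.Icc (-T) T, ∀ s ∈ Set.Icc (-T) T,
        let U := evolution T Ψ Λ t s
        let U₀ := tensorOp (subset_of_thickening_subset hΛ)
          (evolution T Ψ X t s) (evolution T Ψ (Λ \ X) t s)
        let Û := embed (surface_subset G X Λ R) (Uhat t s)
        let W := U₀ * star U
        let normΨ := (interactionNorm G (fun r => F r * ξ r) T Ψ).toReal
        let normF := (decayNorm G F).toReal
        let normFξ := (decayNorm G (fun r => F r * ξ r)).toReal
        let Cξ := (convConst G (fun r => F r * ξ r)).toReal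
        let κ := g ^ 2 * normFξ / Cξ
        let v := 2 * normΨ * Cξ
        let area := ((innerBoundary G X).ncard : ℝ)
        Uhat t s ∈ unitary (LocalAlgebra q (surface G X Λ R)) ∧
        ‖U - star Û * U₀‖ = ‖star W - star Û‖ ∧
        ‖U - star Û * U₀‖ ≤ |∫ r in s..t, ‖sigma T Ψ Λ t r (negCrossingEnergy Ψ X Λ r) +
            embed (surface_subset G X Λ R)
              (sigma T Ψ (surface G X Λ R) t r (surfaceEnergy G Ψ X Λ R r))‖| ∧
        ‖U - star Û * U₀‖ ≤ area * normΨ * normF * |t - s| *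
          (2 * zetaTail ξ (R / 2) +
            area * κ * ((R / 2 : ℕ) : ℝ) ^ (2 * d) * ξ ((R / 2 : ℕ) : ℝ) *
              (Real.exp (v * |t - s|) - 1)) := by
  have hξ_sum := summable_nat_of_decay hξ_decay
  have hXΛ := subset_of_thickening_subset hΛ
  refine ⟨exists_isLeftSurfaceEvolution hT hΨ_sa hΨ_cont R, ?_⟩
  intro Uhat hUhat t ht s hs U U₀ Û W normΨ normF normFξ Cξ κ v area
  have hcard : ((surface G X Λ (R / 2)).card : ℝ) ≤
      g * ((R / 2 : ℕ) : ℝ) ^ d * (innerBoundary G X).ncard := by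
    -- `Λ` contains the thickening of width `R`, hence that of width `⌊R/2⌋`, so truncating the
    -- fattened surface to `Λ` loses no point.
    have h1 : thickening G (X : Set Γ) (R / 2) ⊆ (Λ : Set Γ) := by
      rintro x ⟨y, hy, hxy⟩
      exact hΛ ⟨y, hy, hxy.trans (Nat.div_le_self R 2)⟩
    rw [← Set.ncard_coe_finset, coe_surface h1]
    exact hfat X (R / 2)
  set ι := surface_subset G X Λ R
  have hÛ := (isLeftSurfaceEvolution_iff G hΨ_sa X Λ R Uhat).1 hUhat t ht
  have hSsa : ∀ r ∈ Set.Icc (-T) T, IsSelfAdjoint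
      (-sigma T Ψ (surface G X Λ R) t r (surfaceEnergy G Ψ X Λ R r)) := fun r hr =>
    (isSelfAdjoint_sigma (isSelfAdjoint_interactionSum hΨ_sa _ _ hr) r).neg
  have hSc : ContinuousOn (fun r => -sigma T Ψ (surface G X Λ R) t r
      (surfaceEnergy G Ψ X Λ R r)) (Set.Icc (-T) T) :=
    (continuousOn_sigma hT hΨ_sa hΨ_cont _ ht (continuousOn_surfaceEnergy hΨ_cont R)).neg
  have hÛΛ := hÛ.map (embedHom ι)
  simp only [embedHom_apply] at hÛΛ
  have hW := isFlow_tensorOp_mul_star hT hΨ_sa hΨ_cont hXΛ ht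
  have hKsa : ∀ r ∈ Set.Icc (-T) T, IsSelfAdjoint
      (sigma T Ψ Λ t r (negCrossingEnergy Ψ X Λ r)) := fun r hr =>
    isSelfAdjoint_sigma (isSelfAdjoint_negCrossingEnergy hΨ_sa hr) r
  have hKc := continuousOn_sigma hT hΨ_sa hΨ_cont Λ ht
    (continuousOn_negCrossingEnergy (X := X) hΨ_cont)
  have hUu : U ∈ unitary _ := (isFlow_evolution hT hΨ_sa hΨ_cont Λ ht).mem_unitary
    (isSelfAdjoint_hamiltonian hΨ_sa Λ) ht hs
  have hWu : W ∈ unitary _ := hW.mem_unitary hKsa ht hs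
  have hU₀ : U₀ = W * U := by
    rw [mul_assoc, Unitary.star_mul_self_of_mem hUu, mul_one]
  have hU₀u : U₀ ∈ unitary (LocalAlgebra q Λ) := hU₀ ▸ mul_mem hWu hUu
  -- Both operators compared are now left multiples of the same unitary `U₀`, which drops out of the
  -- norm.
  have hUW : U = star W * U₀ := by
    rw [hU₀, ← mul_assoc, Unitary.star_mul_self_of_mem hWu, one_mul]
  have hnorm : ‖U - star Û * U₀‖ = ‖star W - star Û‖ := by
    conv_lhs => rw [hUW, ← sub_mul]
    exact CStarRing.norm_mul_mem_unitary _ hU₀u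
  have hint : ‖U - star Û * U₀‖ ≤ |∫ r in s..t, ‖sigma T Ψ Λ t r (negCrossingEnergy Ψ X Λ r) +
      embed ι (sigma T Ψ (surface G X Λ R) t r (surfaceEnergy G Ψ X Λ R r))‖| := by
    -- The flows start at `t`, so their comparison integrates from `t` to `s`; the absolute value
    -- absorbs the reversal.
    rw [hnorm, ← star_sub, norm_star, intervalIntegral.integral_symm, abs_neg]
    refine (hW.norm_sub_le hÛΛ hKsa (fun r hr => (hSsa r hr).map (embedHom ι)) hKc
      ((continuous_embed ι).comp_continuousOn hSc) ht hs).trans_eq ?_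
    simp only [← embedHom_apply, map_neg, sub_neg_eq_add]
  refine ⟨hÛ.mem_unitary hSsa ht hs, hnorm, hint, hint.trans ?_⟩
  have hconst := intervalIntegral.norm_integral_le_of_norm_le_const (a := s) (b := t)
    (f := fun r => ‖sigma T Ψ Λ t r (negCrossingEnergy Ψ X Λ r) +
      embed ι (sigma T Ψ (surface G X Λ R) t r (surfaceEnergy G Ψ X Λ R r))‖)
    (C := area * normΨ * normF * (2 * zetaTail ξ (R / 2) +
      area * κ * ((R / 2 : ℕ) : ℝ) ^ (2 * d) * ξ ((R / 2 : ℕ) : ℝ) *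
        (Real.exp (v * |t - s|) - 1)))
    (fun r hr => by
      have hr' := Set.uIoc_subset_uIcc hr
      rw [norm_norm]
      refine (norm_sigma_add_embed_sigma_le hG hF_pos hF_norm hF_conv hξ_pos hξ_anti hξ_super
        hξ_sum hT hΨ_sa hΨ_cont hΨ_norm hg hX hcard ht
        (Set.uIcc_subset_Icc hs ht hr')).trans ?_
      -- The exponential increases with elapsed time, so its value at `|t - s|` bounds the whole
      -- integrand and only the length of the interval remains.
      have hrs : |r - t| ≤ |t - s| := by
        rw [abs_sub_comm]
        exact Set.abs_sub_right_of_mem_uIcc hr'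
      have hξm : 0 ≤ ξ ((R / 2 : ℕ) : ℝ) := (hξ_pos _ (Nat.cast_nonneg _)).le
      simp only [area, normΨ, normF, κ, v, normFξ, Cξ]
      gcongr)
  refine hconst.trans_eq ?_
  ring
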